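/- A card with $n$ attributes is a vector in $\{0,1,2\}^n$. Three distinct cards form a Set if, in every attribute, their three values are either all equal or pairwise different. In the game 2P 3-Value Set, a finite set $C$ of distinct cards with $n$ attributes lies on the table, and two players alternately take turns; in each turn (one round) the player whose turn it is removes from the table three cards that form a Set. No cards are added, and a player who cannot find a Set on her turn loses. Consider the following decision problem: given $n$, $C$ and a number $r\in\mathbb{N}$, can the first player force a win in such a way that the game ends after at most $r$ rounds (counting the moves of both players)? This problem is fixed-parameter tractable with respect to the parameter $r$: there are a computable function $f:\mathbb{N}\to\mathbb{N}$, a polynomial $p$, and an algorithm (a multi-tape Turing machine) that decides every instance $(n,C,r)$ in at most $f(r)\cdot p(N)$ steps, where $N$ is the length of the input string, in which $r$ and $n$ are written in unary and the cards are listed value by value. -/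

import Mathlib

/-- A parameterized decision problem, with instances `α`, yes-instances `P`, parameter `κ`, and
instances written as strings by `enc`, is fixed-parameter tractable: one multi-stack Turing machine
decides, for every instance `a`, whether `P a` holds, within `f (κ a) * p |enc a|` steps, where `f`
is a computable function and `p` is a polynomial. -/
def IsFPT {α Γ : Type} (enc : α → List Γ) (κ : α → ℕ) (P : α → Prop) : Prop :=
  ∃ (M : Turing.TM2ComputableAux Γ Bool) (f : ℕ → ℕ) (p : Polynomial ℕ) (answer : α → Bool),
    Computable f ∧
    (∀ a, answer a = true ↔ P a) ∧
    ∀ a, Nonempty (Turing.TM2OutputsInTime M.tm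
      ((enc a).map M.inputAlphabet.symm)
      (some ((Computability.encodeBool (answer a)).map M.outputAlphabet.symm))
      (f (κ a) * p.eval (enc a).length))

namespace SetGame

/-- A card with `n` attributes, each of which takes one of three values. -/
abbrev Card (n : ℕ) : Type := Fin n → Fin 3

/-- Three cards form a Set if, in each attribute, their values all agree or all differ. -/
def IsSet {n : ℕ} (S : Finset (Card n)) : Prop :=
  S.card = 3 ∧ ∀ i : Fin n,
    (∀ x ∈ S, ∀ y ∈ S, x i = y i) ∨ (∀ x ∈ S, ∀ y ∈ S, x ≠ y → x i ≠ y i)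

mutual

/-- With the cards `C` on the table, the player to move can force the opponent to be left without
a Set after at most `r` further rounds. In each round the player whose turn it is removes one Set,
so that the moves of both players are counted. -/
def MoverWinsWithin {n : ℕ} : ℕ → Finset (Card n) → Prop
  | 0, _ => False
  | r + 1, C => ∃ S ⊆ C, IsSet S ∧ MoverLosesWithin r (C \ S)

/-- With the cards `C` on the table, the opponent of the player to move can force the player to
move to be left without a Set after at most `r` further rounds. -/
def MoverLosesWithin {n : ℕ} : ℕ → Finset (Card n) → Prop
  | 0, C => ∀ S ⊆ C, ¬ IsSet S
  | r + 1, C => ∀ S ⊆ C, IsSet S → MoverWinsWithin r (C \ S)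

end

/-- An instance: a number of attributes, finitely many distinct cards (listed in any order),
and the number of allowed rounds. -/
structure Instance where
  attributes : ℕ
  cards : List (Card attributes)
  nodup : cards.Nodup
  rounds : ℕ

/-- The question asked: can the first player force a win within the allowed number of rounds? -/
def Instance.FirstPlayerWins (I : Instance) : Prop :=
  MoverWinsWithin I.rounds I.cards.toFinset

/-- The input alphabet: the three values, a unary digit and an end mark. -/
inductive Symbol : Type
  | value (v : Fin 3)
  | tick
  | mark

/-- An instance as a string: the number of rounds and the number of attributes in unary, and then
the cards one after the other, each as the list of its values; every item is followed by the end
mark. -/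
def Instance.encode (I : Instance) : List Symbol :=
  List.replicate I.rounds Symbol.tick ++ Symbol.mark ::
    (List.replicate I.attributes Symbol.tick ++ Symbol.mark ::
      I.cards.flatMap fun c => (List.ofFn c).map Symbol.value ++ [Symbol.mark])

end SetGame

-- Cards are vectors over the field with three elements, and three distinct cards form a Set exactly
-- when their sum is zero (`isSet_iff`). If the first player can win within `r` rounds, then some at
-- most `3 * r` cards meet every Set (`exists_hitting`). Every Set that is removed greedily uses up
-- one of these cards, so `3 * r` greedy removals exhaust the Sets (`moves_greedyStep_iterate`). The
-- at most `9 * r` cards removed on the way meet all Sets, and their span `L` is listed with at most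
-- `3 ^ (9 * r)` entries.
--
-- Modulo `L`, the three cards of a Set have sum zero and one of them vanishes, so the other two lie
-- in opposite cosets. The cards outside `L` therefore split into orbits, each the union of a coset
-- and its negative, and a Set involves at most one orbit. If two orbits contain cards in the same
-- pattern, exchanging them by translations preserves the Sets on the table, although the exchange
-- is not affine (`swapFibres`, `isSet_image_swapFibres`). An orbit with `r + 1` further copies can
-- be deleted: a move in it can be mirrored in a copy, and each round spoils at most one copy
-- (`exists_mirror`, `deleteOrbit_iff`). There are at most `4 ^ L.length` patterns, so exhaustive
-- deletion leaves a kernel whose size is bounded in terms of `r` alone (`length_kernel_le`). A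
-- table over all subsets of the kernel then decides the game (`mem_table`, `solve_iff`).
--
-- The algorithm has to become a Turing machine. Structured programs on stacks are compiled to
-- machine code (`Runs.reachesIn`), data are binary trees in prefix notation, and `Feasible`
-- expresses that one program computes a family of values in time polynomial in a bound `B`. This
-- relation is closed under the usual list operations, of which the algorithm is composed. With `B`
-- the product of the input length and `2 ^ kernelBound r`, up to additive constants, a power of `B`
-- splits into a factor depending on `r` and a polynomial in the length.

-- Structured programs and their compilation to stack machines

/-- Structured programs acting on finitely many stacks and a register. -/
inductive Prog {K : Type} (Γ : K → Type) (σ : Type) : Type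
  | load (f : σ → σ)
  | push (k : K) (f : σ → Γ k)
  | pop (k : K) (f : σ → Option (Γ k) → σ)
  | seq (p q : Prog Γ σ)
  | ite (b : σ → Bool) (p q : Prog Γ σ)
  | loop (b : σ → Bool) (p : Prog Γ σ)

namespace Prog

variable {K : Type} {Γ : K → Type} {σ : Type}

/-- `Runs p v S v' S' t`: started with register `v` and stacks `S`, the program `p` ends with
register `v'` and stacks `S'` after at most `t` steps. -/
inductive Runs [DecidableEq K] :
    Prog Γ σ → σ → (∀ k, List (Γ k)) → σ → (∀ k, List (Γ k)) → ℕ → Prop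
  | load (f : σ → σ) (v S) : Runs (load f) v S (f v) S 1
  | push (k : K) (f : σ → Γ k) (v S) :
      Runs (push k f) v S v (Function.update S k (f v :: S k)) 1
  | pop (k : K) (f : σ → Option (Γ k) → σ) (v S) :
      Runs (pop k f) v S (f v (S k).head?) (Function.update S k (S k).tail) 1
  | seq {p q v S v' S' v'' S'' t t'} : Runs p v S v' S' t → Runs q v' S' v'' S'' t' →
      Runs (seq p q) v S v'' S'' (t + t')
  | ite_true {b : σ → Bool} {p q v S v' S' t} : b v = true → Runs p v S v' S' t →
      Runs (ite b p q) v S v' S' (t + 1)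
  | ite_false {b : σ → Bool} {p q v S v' S' t} : b v = false → Runs q v S v' S' t →
      Runs (ite b p q) v S v' S' (t + 1)
  | loop_true {b : σ → Bool} {p v S v' S' v'' S'' t t'} : b v = true → Runs p v S v' S' t →
      Runs (loop b p) v' S' v'' S'' t' → Runs (loop b p) v S v'' S'' (t + t' + 1)
  | loop_false {b : σ → Bool} {p v S} : b v = false → Runs (loop b p) v S v S 1
  | mono {p v S v' S' t n} : Runs p v S v' S' t → t ≤ n → Runs p v S v' S' n

/-- The control points of a program. -/
def Label : Prog Γ σ → Type
  | load _ => Unit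
  | push _ _ => Unit
  | pop _ _ => Unit
  | seq p q => Label p ⊕ Label q
  | ite _ p q => Option (Label p ⊕ Label q)
  | loop _ p => Option (Label p)

instance fintypeLabel : (p : Prog Γ σ) → Fintype p.Label
  | load _ => inferInstanceAs (Fintype Unit)
  | push _ _ => inferInstanceAs (Fintype Unit)
  | pop _ _ => inferInstanceAs (Fintype Unit)
  | seq p q => by
      haveI := fintypeLabel p; haveI := fintypeLabel q
      exact inferInstanceAs (Fintype (Label p ⊕ Label q))
  | ite _ p q => by
      haveI := fintypeLabel p; haveI := fintypeLabel q
      exact inferInstanceAs (Fintype (Option (Label p ⊕ Label q)))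
  | loop _ p => by
      haveI := fintypeLabel p
      exact inferInstanceAs (Fintype (Option (Label p)))

/-- The control point at which the execution of a program starts. -/
def entry : (p : Prog Γ σ) → p.Label
  | load _ => ()
  | push _ _ => ()
  | pop _ _ => ()
  | seq p _ => Sum.inl (entry p)
  | ite _ _ _ => none
  | loop _ _ => none

/-- The stack machine code of a program whose control points are embedded into `Λ` by `emb`, and
which jumps to `exit` at the end. -/
def code {Λ : Type} : (p : Prog Γ σ) → (emb : p.Label → Λ) → (exit : Λ) → p.Label →
    Turing.TM2.Stmt Γ Λ σ
  | load f, _, exit, _ => .load f (.goto fun _ => exit)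
  | push k f, _, exit, _ => .push k f (.goto fun _ => exit)
  | pop k f, _, exit, _ => .pop k f (.goto fun _ => exit)
  | seq p q, emb, exit, l => match l with
    | Sum.inl l => code p (fun x => emb (Sum.inl x)) (emb (Sum.inr (entry q))) l
    | Sum.inr l => code q (fun x => emb (Sum.inr x)) exit l
  | ite b p q, emb, exit, l => match l with
    | none => .branch b (.goto fun _ => emb (some (Sum.inl (entry p))))
        (.goto fun _ => emb (some (Sum.inr (entry q))))
    | some (Sum.inl l) => code p (fun x => emb (some (Sum.inl x))) exit l
    | some (Sum.inr l) => code q (fun x => emb (some (Sum.inr x))) exit l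
  | loop b p, emb, exit, l => match l with
    | none => .branch b (.goto fun _ => emb (some (entry p))) (.goto fun _ => exit)
    | some l => code p (fun x => emb (some x)) (emb none) l

/-- `c` reaches `c'` within `t` steps of the machine `M`. -/
def ReachesIn [DecidableEq K] {Λ : Type} (M : Λ → Turing.TM2.Stmt Γ Λ σ)
    (c c' : Turing.TM2.Cfg Γ Λ σ) (t : ℕ) : Prop :=
  ∃ n ≤ t, (flip bind (Turing.TM2.step M))^[n] (some c) = some c'

theorem ReachesIn.trans [DecidableEq K] {Λ : Type} {M : Λ → Turing.TM2.Stmt Γ Λ σ}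
    {c c' c'' : Turing.TM2.Cfg Γ Λ σ} {t t' : ℕ} (h : ReachesIn M c c' t)
    (h' : ReachesIn M c' c'' t') : ReachesIn M c c'' (t + t') := by
  obtain ⟨n, hn, h⟩ := h
  obtain ⟨m, hm, h'⟩ := h'
  refine ⟨m + n, by omega, ?_⟩
  rw [Function.iterate_add_apply, h, h']

theorem ReachesIn.single [DecidableEq K] {Λ : Type} {M : Λ → Turing.TM2.Stmt Γ Λ σ}
    {c c' : Turing.TM2.Cfg Γ Λ σ} (h : Turing.TM2.step M c = some c') : ReachesIn M c c' 1 :=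
  ⟨1, le_rfl, h⟩

/-- The embedding of the labels and the exit label are arbitrary so that the induction applies to
subprograms: the first part of a sequence exits to the entry of the second, and the body of a loop
exits to the test of the loop. -/
theorem Runs.reachesIn [DecidableEq K] {p : Prog Γ σ} {v v' : σ} {S S' : ∀ k, List (Γ k)} {t : ℕ}
    (h : Runs p v S v' S' t) {Λ : Type} (M : Λ → Turing.TM2.Stmt Γ Λ σ) (emb : p.Label → Λ)
    (exit : Λ) (hM : ∀ l, M (emb l) = code p emb exit l) :
    ReachesIn M ⟨some (emb p.entry), v, S⟩ ⟨some exit, v', S'⟩ t := by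
  induction h generalizing exit with
  | load f v S =>
    refine .single ?_
    rw [Turing.TM2.step, hM]; rfl
  | push k f v S =>
    refine .single ?_
    rw [Turing.TM2.step, hM]; rfl
  | pop k f v S =>
    refine .single ?_
    rw [Turing.TM2.step, hM]; rfl
  | @seq p q v S v' S' v'' S'' t t' _ _ ih₁ ih₂ =>
    refine (ih₁ (fun x => emb (Sum.inl x)) (emb (Sum.inr (entry q))) ?_).trans
      (ih₂ (fun x => emb (Sum.inr x)) exit ?_)
    · exact fun l => hM (Sum.inl l)
    · exact fun l => hM (Sum.inr l)
  | @ite_true b p q v S v' S' t hb _ ih =>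
    rw [add_comm]
    refine ReachesIn.trans (.single ?_) (ih (fun x => emb (some (Sum.inl x))) exit ?_)
    · rw [Turing.TM2.step, hM]
      simp only [entry, code, Turing.TM2.stepAux, hb, cond_true]
    · exact fun l => hM (some (Sum.inl l))
  | @ite_false b p q v S v' S' t hb _ ih =>
    rw [add_comm]
    refine ReachesIn.trans (.single ?_) (ih (fun x => emb (some (Sum.inr x))) exit ?_)
    · rw [Turing.TM2.step, hM]
      simp only [entry, code, Turing.TM2.stepAux, hb, cond_false]
    · exact fun l => hM (some (Sum.inr l))
  | @loop_true b p v S v' S' v'' S'' t t' hb _ _ ih₁ ih₂ =>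
    rw [add_comm]
    refine ReachesIn.trans (c' := ⟨some (emb (some (entry p))), v, S⟩) (.single ?_)
      (ReachesIn.trans (ih₁ (fun x => emb (some x)) (emb none) ?_) (ih₂ emb exit hM))
    · rw [Turing.TM2.step, hM]
      simp only [entry, code, Turing.TM2.stepAux, hb, cond_true]
    · exact fun l => hM (some l)
  | @loop_false b p v S hb =>
    refine .single ?_
    rw [Turing.TM2.step, hM]
    simp only [entry, code, Turing.TM2.stepAux, hb, cond_false]
  | mono _ hle ih =>
    obtain ⟨n, hn, h⟩ := ih emb exit hM
    exact ⟨n, hn.trans hle, h⟩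

/-- The machine that executes a program and halts. -/
def machine [DecidableEq K] [Fintype K] [Fintype σ] (p : Prog Γ σ) (k₀ k₁ : K) [Fintype (Γ k₀)]
    (v : σ) : Turing.FinTM2 where
  K := K
  k₀ := k₀
  k₁ := k₁
  Γ := Γ
  Λ := Option p.Label
  main := some p.entry
  ΛFin := inferInstance
  σ := σ
  initialState := v
  m := fun l => match l with
    | none => .halt
    | some l => code p some none l

theorem Runs.outputsInTime [DecidableEq K] [Fintype K] [Fintype σ] {p : Prog Γ σ} {k₀ k₁ : K}
    [Fintype (Γ k₀)] {v : σ} {S S' : ∀ k, List (Γ k)} {s : List (Γ k₀)} {s' : List (Γ k₁)} {t : ℕ}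
    (h : Runs p v S v S' t) (hS : (Turing.initList (machine p k₀ k₁ v) s).stk = S)
    (hS' : (Turing.haltList (machine p k₀ k₁ v) s').stk = S') :
    Nonempty (Turing.TM2OutputsInTime (machine p k₀ k₁ v) s (some s') (t + 1)) := by
  subst hS hS'
  -- The extra step executes the halt statement at the label `none`.
  have h₁ := (h.reachesIn (machine p k₀ k₁ v).m some none fun l => rfl).trans
    (ReachesIn.single (c' := Turing.haltList (machine p k₀ k₁ v) s') rfl)
  obtain ⟨n, hn, h₁⟩ := h₁
  exact ⟨⟨⟨n, h₁⟩, hn⟩⟩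

end Prog

-- Elementary programs on five symbol stacks and an output stack

namespace SetGame

open Prog

instance : DecidableEq Symbol
  | .value v, .value w => decidable_of_iff (v = w) (by simp)
  | .tick, .tick => isTrue rfl
  | .mark, .mark => isTrue rfl
  | .value _, .tick => isFalse (by simp)
  | .value _, .mark => isFalse (by simp)
  | .tick, .value _ => isFalse (by simp)
  | .tick, .mark => isFalse (by simp)
  | .mark, .value _ => isFalse (by simp)
  | .mark, .tick => isFalse (by simp)

instance : Fintype Symbol where
  elems := {.value 0, .value 1, .value 2, .tick, .mark}
  complete s := by
    cases s with
    | value v => fin_cases v <;> simp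
    | tick => simp
    | mark => simp

/-- The stacks other than the output. -/
inductive Stack : Type
  | input
  | main
  | left
  | right
  | count

instance : DecidableEq Stack := fun j k => by
  cases j <;> cases k <;> first | exact isTrue rfl | exact isFalse nofun

instance : Fintype Stack where
  elems := {.input, .main, .left, .right, .count}
  complete k := by cases k <;> simp

/-- The stack alphabets; the output stack is `none`. -/
abbrev Alphabet : Option Stack → Type
  | none => Bool
  | some _ => Symbol

/-- The register: the symbol read last, if there was one, and a flag. -/
abbrev Register : Type := Option Symbol × Bool

/-- Programs on the stacks. -/
abbrev StackProg : Type := Prog Alphabet Register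

/-- The stacks with the given contents. -/
def conf (i m a b c : List Symbol) (o : List Bool) : ∀ k, List (Alphabet k)
  | none => o
  | some .input => i
  | some .main => m
  | some .left => a
  | some .right => b
  | some .count => c

section

variable (i m a b c : List Symbol) (o : List Bool)

theorem conf_update_none (x : List Bool) :
    Function.update (conf i m a b c o) none x = conf i m a b c x := by
  funext k; rcases k with _ | _ | _ <;> rfl

theorem conf_update_input (x : List Symbol) :
    Function.update (conf i m a b c o) (some .input) x = conf x m a b c o := by
  funext k; rcases k with _ | _ | _ <;> rfl

theorem conf_update_main (x : List Symbol) :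
    Function.update (conf i m a b c o) (some .main) x = conf i x a b c o := by
  funext k; rcases k with _ | _ | _ <;> rfl

theorem conf_update_left (x : List Symbol) :
    Function.update (conf i m a b c o) (some .left) x = conf i m x b c o := by
  funext k; rcases k with _ | _ | _ <;> rfl

theorem conf_update_right (x : List Symbol) :
    Function.update (conf i m a b c o) (some .right) x = conf i m a x c o := by
  funext k; rcases k with _ | _ | _ <;> rfl

theorem conf_update_count (x : List Symbol) :
    Function.update (conf i m a b c o) (some .count) x = conf i m a b x o := by
  funext k; rcases k with _ | _ | _ <;> rfl

end

/-- Read a symbol from a stack into the register. -/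
def read (k : Stack) : StackProg := .pop (some k) fun v s => (s, v.2)

/-- Write the symbol in the register to a stack. -/
def write (k : Stack) : StackProg := .push (some k) fun v => v.1.getD .tick

/-- Write a given symbol to a stack. -/
def put (k : Stack) (s : Symbol) : StackProg := .push (some k) fun _ => s

/-- Do nothing. -/
def skip : StackProg := .load id

/-- Empty a stack, executing `p` after reading each symbol. -/
def flush (k : Stack) (p : StackProg) : StackProg :=
  .seq (read k) (.loop (fun v => v.1.isSome) (.seq p (read k)))

section

variable {i m a b c : List Symbol} {o : List Bool} {v : Register} {s : Symbol} {w : Bool}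

theorem runs_skip {S} : Runs skip v S v S 1 := .load id v S

theorem runs_read_input :
    Runs (read .input) v (conf i m a b c o) (i.head?, v.2) (conf i.tail m a b c o) 1 := by
  have := Runs.pop (some Stack.input) (fun v s => (s, v.2)) v (conf i m a b c o)
  rwa [conf_update_input] at this

theorem runs_read_main :
    Runs (read .main) v (conf i m a b c o) (m.head?, v.2) (conf i m.tail a b c o) 1 := by
  have := Runs.pop (some Stack.main) (fun v s => (s, v.2)) v (conf i m a b c o)
  rwa [conf_update_main] at this

theorem runs_read_left :
    Runs (read .left) v (conf i m a b c o) (a.head?, v.2) (conf i m a.tail b c o) 1 := by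
  have := Runs.pop (some Stack.left) (fun v s => (s, v.2)) v (conf i m a b c o)
  rwa [conf_update_left] at this

theorem runs_read_right :
    Runs (read .right) v (conf i m a b c o) (b.head?, v.2) (conf i m a b.tail c o) 1 := by
  have := Runs.pop (some Stack.right) (fun v s => (s, v.2)) v (conf i m a b c o)
  rwa [conf_update_right] at this

theorem runs_read_count :
    Runs (read .count) v (conf i m a b c o) (c.head?, v.2) (conf i m a b c.tail o) 1 := by
  have := Runs.pop (some Stack.count) (fun v s => (s, v.2)) v (conf i m a b c o)
  rwa [conf_update_count] at this

theorem runs_write_main :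
    Runs (write .main) (some s, w) (conf i m a b c o) (some s, w) (conf i (s :: m) a b c o) 1 := by
  have := Runs.push (some Stack.main) (fun v : Register => v.1.getD .tick) (some s, w)
    (conf i m a b c o)
  rwa [conf_update_main] at this

theorem runs_write_left :
    Runs (write .left) (some s, w) (conf i m a b c o) (some s, w) (conf i m (s :: a) b c o) 1 := by
  have := Runs.push (some Stack.left) (fun v : Register => v.1.getD .tick) (some s, w)
    (conf i m a b c o)
  rwa [conf_update_left] at this

theorem runs_write_right :
    Runs (write .right) (some s, w) (conf i m a b c o) (some s, w) (conf i m a (s :: b) c o) 1 := by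
  have := Runs.push (some Stack.right) (fun v : Register => v.1.getD .tick) (some s, w)
    (conf i m a b c o)
  rwa [conf_update_right] at this

theorem runs_write_count :
    Runs (write .count) (some s, w) (conf i m a b c o) (some s, w) (conf i m a b (s :: c) o) 1 := by
  have := Runs.push (some Stack.count) (fun v : Register => v.1.getD .tick) (some s, w)
    (conf i m a b c o)
  rwa [conf_update_count] at this

theorem runs_put_main :
    Runs (put .main s) v (conf i m a b c o) v (conf i (s :: m) a b c o) 1 := by
  have := Runs.push (some Stack.main) (fun _ : Register => s) v (conf i m a b c o)
  rwa [conf_update_main] at this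

theorem runs_put_count :
    Runs (put .count s) v (conf i m a b c o) v (conf i m a b (s :: c) o) 1 := by
  have := Runs.push (some Stack.count) (fun _ : Register => s) v (conf i m a b c o)
  rwa [conf_update_count] at this

end

/-- Emptying a stack. The stacks are described by `st`, depending on what is left on the stack
and on the list of the symbols already read. -/
theorem runs_flush {k : Stack} {p : StackProg} {n : ℕ}
    (st : List Symbol → List Symbol → ∀ k, List (Alphabet k))
    (hk : ∀ v l d, Runs (read k) v (st l d) (l.head?, v.2) (st l.tail d) 1)
    (hp : ∀ s w l d, Runs p (some s, w) (st l d) (some s, w) (st l (s :: d)) n)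
    (l d : List Symbol) (v : Register) :
    Runs (flush k p) v (st l d) (none, v.2) (st [] (l.reverse ++ d)) ((n + 2) * l.length + 2) := by
  have key : ∀ (l d : List Symbol) (w : Bool),
      Runs (.loop (fun v => v.1.isSome) (.seq p (read k))) (l.head?, w) (st l.tail d)
        (none, w) (st [] (l.reverse ++ d)) ((n + 2) * l.length + 1) := by
    intro l
    induction l with
    | nil => intro d w; exact .loop_false rfl
    | cons s l ih =>
      intro d w
      have h := Runs.loop_true (b := fun v : Register => v.1.isSome) rfl
        (.seq (hp s w l d) (hk _ _ _)) (ih (s :: d) w)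
      have e : (s :: l).reverse ++ d = l.reverse ++ (s :: d) := by simp
      rw [e]
      refine h.mono ?_
      simp only [List.length_cons]
      ring_nf; omega
  exact (Runs.seq (hk v l d) (key l d v.2)).mono (by omega)

section

variable {i m a b c : List Symbol} {o : List Bool} {v : Register}

theorem runs_flush_left_main : Runs (flush .left (write .main)) v (conf i m a b c o)
    (none, v.2) (conf i (a.reverse ++ m) [] b c o) (3 * a.length + 2) :=
  runs_flush (fun l d => conf i d l b c o) (fun _ _ _ => runs_read_left)
    (fun _ _ _ _ => runs_write_main) a m v

theorem runs_flush_left_right : Runs (flush .left (write .right)) v (conf i m a b c o)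
    (none, v.2) (conf i m [] (a.reverse ++ b) c o) (3 * a.length + 2) :=
  runs_flush (fun l d => conf i m l d c o) (fun _ _ _ => runs_read_left)
    (fun _ _ _ _ => runs_write_right) a b v

theorem runs_flush_left_count : Runs (flush .left (write .count)) v (conf i m a b c o)
    (none, v.2) (conf i m [] b (a.reverse ++ c) o) (3 * a.length + 2) :=
  runs_flush (fun l d => conf i m l b d o) (fun _ _ _ => runs_read_left)
    (fun _ _ _ _ => runs_write_count) a c v

theorem runs_flush_right_left : Runs (flush .right (write .left)) v (conf i m a b c o)
    (none, v.2) (conf i m (b.reverse ++ a) [] c o) (3 * b.length + 2) :=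
  runs_flush (fun l d => conf i m d l c o) (fun _ _ _ => runs_read_right)
    (fun _ _ _ _ => runs_write_left) b a v

theorem runs_flush_input_left : Runs (flush .input (write .left)) v (conf i m a b c o)
    (none, v.2) (conf [] m (i.reverse ++ a) b c o) (3 * i.length + 2) :=
  runs_flush (fun l d => conf l m d b c o) (fun _ _ _ => runs_read_input)
    (fun _ _ _ _ => runs_write_left) i a v

theorem runs_flush_left_skip : Runs (flush .left skip) v (conf i m a b c o)
    (none, v.2) (conf i m [] b c o) (3 * a.length + 2) :=
  runs_flush (fun l _ => conf i m l b c o) (fun _ _ _ => runs_read_left)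
    (fun _ _ _ _ => runs_skip) a [] v

theorem runs_flush_count_skip : Runs (flush .count skip) v (conf i m a b c o)
    (none, v.2) (conf i m a b [] o) (3 * c.length + 2) :=
  runs_flush (fun l _ => conf i m a b l o) (fun _ _ _ => runs_read_count)
    (fun _ _ _ _ => runs_skip) c [] v

theorem runs_flush_left_main_right :
    Runs (flush .left (.seq (write .main) (write .right))) v (conf i m a [] c o)
    (none, v.2) (conf i (a.reverse ++ m) [] a.reverse c o) (4 * a.length + 2) := by
  have h := runs_flush (fun l d => conf i (d ++ m) l d c o) (fun _ _ _ => runs_read_left)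
    (fun _ _ _ _ => .seq runs_write_main runs_write_right) a [] v
  simpa using h

end

-- Trees in prefix notation and their manipulation

/-- Binary trees, the data of computations. -/
inductive Datum : Type
  | nil
  | cons (x y : Datum)

namespace Datum

/-- Prefix notation of a tree. -/
def code : Datum → List Symbol
  | nil => [.tick]
  | cons x y => .mark :: (code x ++ code y)

/-- The length of the prefix notation of a tree. -/
def size (x : Datum) : ℕ := x.code.length

@[simp] theorem size_nil : size nil = 1 := rfl

@[simp] theorem size_cons (x y : Datum) : size (cons x y) = size x + size y + 1 := by
  simp [size, code]

theorem length_code (x : Datum) : x.code.length = x.size := rfl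

/-- Prefix notation is prefix-free. The remainders `s` and `t` are needed for the induction, since
the code of the second component follows that of the first. -/
theorem code_append_inj : ∀ {x y : Datum} {s t : List Symbol}, x.code ++ s = y.code ++ t →
    x = y ∧ s = t
  | nil, nil, _, _, h => by simpa [code] using h
  | nil, cons _ _, _, _, h => by simp [code] at h
  | cons _ _, nil, _, _, h => by simp [code] at h
  | cons a b, cons c d, s, t, h => by
    simp only [code, List.cons_append, List.append_assoc, List.cons.injEq, true_and] at h
    obtain ⟨h₁, h⟩ := code_append_inj h
    obtain ⟨h₂, h⟩ := code_append_inj h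
    exact ⟨h₁ ▸ h₂ ▸ rfl, h⟩

theorem code_inj {x y : Datum} : x.code = y.code ↔ x = y :=
  ⟨fun h => (code_append_inj (s := []) (t := []) (by simpa using h)).1, fun h => h ▸ rfl⟩

/-- Truth values as trees. -/
def ofBool : Bool → Datum
  | false => nil
  | true => cons nil nil

end Datum

/-- One step of the transfer of a tree from the main stack to the left stack. The counter and the
register hold the number of subtrees that are still to be transferred. -/
def moveStep : StackProg :=
  .seq (read .main) (.seq (write .left)
    (.seq (.ite (fun v => v.1 = some .mark) (.seq (put .count .tick) (put .count .tick)) skip)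
      (read .count)))

/-- Transfer of a tree from the main stack to the left stack. -/
def move : StackProg :=
  .seq (.load fun v => (some .tick, v.2)) (.loop (fun v => v.1.isSome) moveStep)

/-- The rest of the run is a hypothesis, so the two components of a pair are handled by chaining the
induction hypotheses. A mark replaces one pending subtree by two: two ticks are pushed and one is
read back. Each symbol costs at most seven steps. -/
theorem runs_move_loop (x : Datum) : ∀ {i m a b c : List Symbol} {o : List Bool} {w : Bool}
    {s : Symbol} {v' S' t},
    Runs (.loop (fun v => v.1.isSome) moveStep) (c.head?, w)
      (conf i m (x.code.reverse ++ a) b c.tail o) v' S' t →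
    Runs (.loop (fun v => v.1.isSome) moveStep) (some s, w) (conf i (x.code ++ m) a b c o) v' S'
      (7 * x.size + t) := by
  induction x with
  | nil =>
    intro i m a b c o w s v' S' t h
    exact (Runs.loop_true rfl (.seq runs_read_main (.seq runs_write_left
      (.seq (.ite_false rfl runs_skip) runs_read_count))) h).mono (by simp)
  | cons x y ihx ihy =>
    intro i m a b c o w s v' S' t h
    have h' := ihx (c := .tick :: c) (a := .mark :: a) (m := y.code ++ m) (s := .tick)
      (ihy (m := m) (c := c) (by simpa [Datum.code] using h))
    have h'' := Runs.loop_true (v := (some s, w)) (b := fun v : Register => v.1.isSome) rfl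
      (.seq (runs_read_main (m := .mark :: (x.code ++ (y.code ++ m)))) (.seq runs_write_left
      (.seq (.ite_true rfl (.seq runs_put_count runs_put_count)) runs_read_count))) h'
    rw [show (Datum.cons x y).code ++ m = .mark :: (x.code ++ (y.code ++ m)) by simp [Datum.code]]
    refine h''.mono ?_
    rw [Datum.size_cons]
    omega

theorem runs_move (x : Datum) {i m a b : List Symbol} {o : List Bool} {v : Register} :
    Runs move v (conf i (x.code ++ m) a b [] o) (none, v.2)
      (conf i m (x.code.reverse ++ a) b [] o) (7 * x.size + 2) :=
  (Runs.seq (.load _ _ _) (runs_move_loop x (c := []) (.loop_false rfl))).mono (by omega)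

/-- Duplicate the tree on top of the main stack. -/
def dup : StackProg :=
  .seq move (.seq (flush .left (.seq (write .main) (write .right)))
    (.seq (flush .right (write .left)) (flush .left (write .main))))

theorem runs_dup (x : Datum) {m : List Symbol} {i : List Symbol} {o : List Bool} {v : Register} :
    Runs dup v (conf i (x.code ++ m) [] [] [] o) (none, v.2)
      (conf i (x.code ++ (x.code ++ m)) [] [] [] o) (17 * x.size + 8) := by
  have h := Runs.seq (runs_move x (i := i) (m := m) (a := []) (b := []) (o := o) (v := v))
    (.seq runs_flush_left_main_right (.seq runs_flush_right_left runs_flush_left_main))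
  simp only [List.append_nil, List.reverse_reverse, List.length_reverse, Datum.length_code] at h
  exact h.mono (by omega)

/-- Exchange the two trees on top of the main stack. -/
def swap : StackProg :=
  .seq move (.seq (flush .left (write .right)) (.seq move
    (.seq (flush .right (write .left)) (flush .left (write .main)))))

theorem runs_swap (x y : Datum) {m : List Symbol} {i : List Symbol} {o : List Bool}
    {v : Register} :
    Runs swap v (conf i (x.code ++ (y.code ++ m)) [] [] [] o) (none, v.2)
      (conf i (y.code ++ (x.code ++ m)) [] [] [] o) (16 * x.size + 10 * y.size + 10) := by
  have h := Runs.seq (runs_move x (i := i) (m := y.code ++ m) (a := []) (b := []) (o := o) (v := v))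
    (.seq runs_flush_left_right (.seq (runs_move y)
      (.seq runs_flush_right_left runs_flush_left_main)))
  simp only [List.append_nil, List.reverse_reverse, List.length_reverse, Datum.length_code,
    List.reverse_append, List.append_assoc, List.length_append] at h
  exact h.mono (by omega)

/-- Remove the tree on top of the main stack. -/
def drop : StackProg := .seq move (flush .left skip)

theorem runs_drop (x : Datum) {m : List Symbol} {i : List Symbol} {o : List Bool} {v : Register} :
    Runs drop v (conf i (x.code ++ m) [] [] [] o) (none, v.2)
      (conf i m [] [] [] o) (10 * x.size + 4) := by
  have h := Runs.seq (runs_move x (i := i) (m := m) (a := []) (b := []) (o := o) (v := v))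
    runs_flush_left_skip
  simp only [List.append_nil, List.length_reverse, Datum.length_code] at h
  exact h.mono (by omega)

/-- Write a constant tree to the main stack. -/
def putDatum : Datum → StackProg
  | .nil => put .main .tick
  | .cons x y => .seq (putDatum y) (.seq (putDatum x) (put .main .mark))

theorem runs_putDatum (x : Datum) : ∀ {i m a b c : List Symbol} {o : List Bool} {v : Register},
    Runs (putDatum x) v (conf i m a b c o) v (conf i (x.code ++ m) a b c o) x.size := by
  induction x with
  | nil => intros; exact runs_put_main
  | cons x y ihx ihy =>
    intro i m a b c o v
    have h := Runs.seq (ihy (m := m) (i := i) (a := a) (b := b) (c := c) (o := o) (v := v))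
      (.seq ihx (runs_put_main (s := .mark)))
    rw [show (Datum.cons x y).code ++ m = .mark :: (x.code ++ (y.code ++ m)) by simp [Datum.code]]
    exact h.mono (by simp; omega)

/-- Compare the contents of the right stack and of the counter. -/
def compare : StackProg :=
  .seq (read .right) (.seq (.pop (some .count) fun v s => (v.1, v.2 && decide (v.1 = s)))
    (.loop (fun v => v.1.isSome) (.seq (read .right)
      (.pop (some .count) fun v s => (v.1, v.2 && decide (v.1 = s))))))

/-- The loop ends with the right stack. If the counter is longer, the last comparison of `none` with
a symbol clears the flag and a remainder `c'` stays behind, which the caller has to discard. -/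
theorem runs_compare {i m a : List Symbol} {o : List Bool} (b c : List Symbol) (v : Register) :
    ∃ c', c'.length ≤ c.length ∧ Runs compare v (conf i m a b c o) (none, v.2 && decide (b = c))
      (conf i m a [] c' o) (3 * b.length + 3) := by
  have hpop : ∀ {v : Register} {b c : List Symbol},
      Runs (.pop (some .count) fun v s => (v.1, v.2 && decide (v.1 = s))) v (conf i m a b c o)
      (v.1, v.2 && decide (v.1 = c.head?)) (conf i m a b c.tail o) 1 := by
    intro v b c
    have := Runs.pop (some Stack.count)
      (fun (v : Register) s => (v.1, v.2 && decide (v.1 = s))) v (conf i m a b c o)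
    rwa [conf_update_count] at this
  have key : ∀ (b c : List Symbol) (w : Bool), ∃ c', c'.length ≤ c.length ∧
      Runs (.loop (fun v => v.1.isSome) (.seq (read .right)
        (.pop (some .count) fun v s => (v.1, v.2 && decide (v.1 = s)))))
        (b.head?, w && decide (b.head? = c.head?)) (conf i m a b.tail c.tail o)
        (none, w && decide (b = c)) (conf i m a [] c' o) (3 * b.length + 1) := by
    intro b
    induction b with
    | nil =>
      intro c w
      refine ⟨c.tail, by simp, ?_⟩
      have e : (decide (([] : List Symbol).head? = c.head?)) = decide ([] = c) := by
        cases c <;> simp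
      rw [e]
      exact .loop_false rfl
    | cons s b ih =>
      intro c w
      obtain ⟨c', hc', h⟩ := ih c.tail (w && decide ((s :: b).head? = c.head?))
      refine ⟨c', hc'.trans (by simp), ?_⟩
      have h' := Runs.loop_true (v := (some s, w && decide ((s :: b).head? = c.head?)))
        (b := fun v : Register => v.1.isSome) rfl (.seq runs_read_right hpop) h
      have e : (w && decide ((s :: b).head? = c.head?) && decide (b = c.tail)) =
          (w && decide (s :: b = c)) := by
        rw [Bool.and_assoc]
        congr 1
        cases c
        · simp
        · rw [Bool.eq_iff_iff]
          simp
          exact fun _ => decide_eq_true_iff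
      rw [e] at h'
      exact h'.mono (by simp; omega)
  obtain ⟨c', hc', h⟩ := key b c v.2
  exact ⟨c', hc', (Runs.seq runs_read_right (.seq hpop h)).mono (by omega)⟩

end SetGame

-- Functions bounded by a power

/-- The function `f` is bounded by a power of `B + 2`. -/
def PowerBounded {α : Type} (B f : α → ℕ) : Prop := ∃ d : ℕ, ∀ a, f a ≤ (B a + 2) ^ d

namespace PowerBounded

variable {α β : Type} {B f g : α → ℕ}

theorem mono (hg : PowerBounded B g) (h : ∀ a, f a ≤ g a) : PowerBounded B f :=
  hg.imp fun _ hd a => (h a).trans (hd a)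

theorem const (n : ℕ) : PowerBounded B fun _ => n :=
  ⟨n, fun a => Nat.lt_two_pow_self.le.trans (Nat.pow_le_pow_left (by omega) n)⟩

theorem self : PowerBounded B B := ⟨1, fun a => by simp⟩

theorem mul (hf : PowerBounded B f) (hg : PowerBounded B g) :
    PowerBounded B fun a => f a * g a := by
  obtain ⟨d, hd⟩ := hf
  obtain ⟨d', hd'⟩ := hg
  exact ⟨d + d', fun a => by rw [pow_add]; exact Nat.mul_le_mul (hd a) (hd' a)⟩

/-- Since the base `B a + 2` is at least two, one more factor absorbs the summand; this is why
powers of `B a + 2` are used instead of powers of `B a`. -/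
theorem succ (hf : PowerBounded B f) : PowerBounded B fun a => f a + 1 := by
  obtain ⟨d, hd⟩ := hf
  refine ⟨d + 1, fun a => ?_⟩
  have h₁ : 1 ≤ (B a + 2) ^ d := Nat.one_le_pow _ _ (by omega)
  calc f a + 1 ≤ (B a + 2) ^ d * 2 := by have := hd a; omega
    _ ≤ (B a + 2) ^ (d + 1) := by rw [pow_succ]; exact Nat.mul_le_mul_left _ (by omega)

theorem add (hf : PowerBounded B f) (hg : PowerBounded B g) :
    PowerBounded B fun a => f a + g a :=
  (hf.succ.mul hg.succ).mono fun a => by nlinarith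

theorem reindex (hf : PowerBounded B f) (φ : β → α) :
    PowerBounded (fun b => B (φ b)) fun b => f (φ b) :=
  hf.imp fun _ hd b => hd (φ b)

end PowerBounded

-- Programs that compute functions of trees

namespace SetGame

open Prog

/-- With the tree `x` on top of the main stack, the program `p` replaces it by the tree `y` within
`t` steps. -/
def Computes (p : StackProg) (x y : Datum) (t : ℕ) : Prop :=
  ∀ (v : Register) (m : List Symbol), ∃ v', Runs p v (conf [] (x.code ++ m) [] [] [] [])
    v' (conf [] (y.code ++ m) [] [] [] []) t

theorem Computes.mono {p : StackProg} {x y : Datum} {t t' : ℕ} (h : Computes p x y t)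
    (ht : t ≤ t') : Computes p x y t' := fun v m =>
  let ⟨v', h'⟩ := h v m
  ⟨v', h'.mono ht⟩

theorem computes_skip (x : Datum) : Computes skip x x 1 := fun v _ => ⟨v, runs_skip⟩

theorem Computes.comp {p q : StackProg} {x y z : Datum} {t t' : ℕ} (h : Computes p x y t)
    (h' : Computes q y z t') : Computes (.seq p q) x z (t + t') := fun v m =>
  let ⟨v', h₁⟩ := h v m
  let ⟨v'', h₂⟩ := h' v' m
  ⟨v'', .seq h₁ h₂⟩

theorem computes_const (x y : Datum) :
    Computes (.seq drop (putDatum y)) x y (10 * x.size + y.size + 4) := fun v m =>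
  ⟨_, (Runs.seq (runs_drop x) (runs_putDatum y)).mono (by omega)⟩

theorem Computes.pair {p q : StackProg} {x y z : Datum} {t t' : ℕ} (h : Computes p x y t)
    (h' : Computes q x z t') :
    Computes (.seq dup (.seq p (.seq swap (.seq q (.seq swap (put .main .mark))))))
      x (.cons y z) (t + t' + 60 * (x.size + y.size + z.size + 1)) := by
  intro v m
  have h₁ := runs_dup x (m := m) (i := []) (o := []) (v := v)
  obtain ⟨v₂, h₂⟩ := h (none, v.2) (x.code ++ m)
  obtain ⟨v₃, h₃⟩ := h' (none, v₂.2) (y.code ++ m)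
  have h₄ := Runs.seq h₁ (.seq h₂ (.seq (runs_swap y x) (.seq h₃ (.seq (runs_swap z y)
    (runs_put_main (s := .mark))))))
  rw [show (Datum.cons y z).code ++ m = .mark :: (y.code ++ (z.code ++ m)) by simp [Datum.code]]
  exact ⟨_, h₄.mono (by omega)⟩

theorem computes_fst (x y : Datum) :
    Computes (.seq (read .main) (.seq swap drop)) (.cons x y) x (30 * (x.size + y.size + 1)) := by
  intro v m
  have h := Runs.seq (runs_read_main (v := v) (i := []) (m := (Datum.cons x y).code ++ m)
    (a := []) (b := []) (c := []) (o := []))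
    (.seq (by simpa [Datum.code] using runs_swap x y (i := []) (m := m)) (runs_drop y))
  exact ⟨_, h.mono (by omega)⟩

theorem computes_snd (x y : Datum) :
    Computes (.seq (read .main) drop) (.cons x y) y (30 * (x.size + y.size + 1)) := by
  intro v m
  have h := Runs.seq (runs_read_main (v := v) (i := []) (m := (Datum.cons x y).code ++ m)
    (a := []) (b := []) (c := []) (o := []))
    (by simpa [Datum.code] using runs_drop x (i := []) (m := y.code ++ m))
  exact ⟨_, h.mono (by omega)⟩

/-- Compare the two components of a pair. -/
def eqProg : StackProg :=
  .seq (read .main) (.seq move (.seq (flush .left (write .right)) (.seq move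
    (.seq (flush .left (write .count)) (.seq (.load fun _ => (none, true)) (.seq compare
      (.seq (flush .count skip)
        (.ite (fun v => v.2) (putDatum (.ofBool true)) (putDatum (.ofBool false))))))))))

theorem computes_eqProg (x y : Datum) [Decidable (x = y)] :
    Computes eqProg (.cons x y) (.ofBool (decide (x = y))) (30 * (x.size + y.size + 1)) := by
  intro v m
  have h₁ := runs_read_main (v := v) (i := []) (m := (Datum.cons x y).code ++ m)
    (a := []) (b := []) (c := []) (o := [])
  have e : ((Datum.cons x y).code ++ m).tail = x.code ++ (y.code ++ m) := by simp [Datum.code]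
  rw [e] at h₁
  have h₂ := runs_move x (i := []) (m := y.code ++ m) (a := []) (b := []) (o := [])
    (v := (((Datum.cons x y).code ++ m).head?, v.2))
  have h₃ := runs_flush_left_right (v := (none, v.2)) (i := []) (m := y.code ++ m)
    (a := x.code.reverse ++ []) (b := []) (c := []) (o := [])
  have h₄ := runs_move y (i := []) (m := m) (a := []) (b := x.code) (o := [])
    (v := (none, v.2))
  have h₅ := runs_flush_left_count (v := (none, v.2)) (i := []) (m := m)
    (a := y.code.reverse ++ []) (b := x.code) (c := []) (o := [])
  simp only [List.append_nil, List.reverse_reverse, List.length_reverse] at h₂ h₃ h₄ h₅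
  obtain ⟨c', hc', h₆⟩ := runs_compare (i := []) (m := m) (a := []) (o := []) x.code y.code
    (none, true)
  have h₇ := runs_flush_count_skip (v := (none, true && decide (x.code = y.code))) (i := [])
    (m := m) (a := []) (b := []) (c := c') (o := [])
  have h₈ : Runs (.ite (fun v => v.2) (putDatum (.ofBool true)) (putDatum (.ofBool false)))
      (none, true && decide (x.code = y.code)) (conf [] m [] [] [] [])
      (none, true && decide (x.code = y.code))
      (conf [] ((Datum.ofBool (decide (x = y))).code ++ m) [] [] [] []) 4 := by
    by_cases h : x = y
    · rw [decide_eq_true h]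
      exact .ite_true (by simp [h]) (runs_putDatum (.ofBool true))
    · rw [decide_eq_false h]
      exact (Runs.ite_false (by simp [Datum.code_inj, h]) (runs_putDatum (.ofBool false))).mono
        (by simp [Datum.ofBool])
  refine ⟨_, (Runs.seq h₁ (.seq h₂ (.seq h₃ (.seq h₄ (.seq h₅ (.seq (.load _ _ _) (.seq h₆
    (.seq h₇ h₈)))))))).mono ?_⟩
  simp only [Datum.length_code] at hc' ⊢
  omega

/-- The truth value is recognized by its first symbol. The code of `true` is a mark and two ticks,
so the first branch has to remove two further symbols. -/
theorem Computes.ite {p q r : StackProg} {x y : Datum} {c : Bool} {t t' : ℕ}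
    (h : Computes p x (.ofBool c) t) (hq : c = true → Computes q x y t')
    (hr : c = false → Computes r x y t') :
    Computes (.seq dup (.seq p (.seq (read .main) (.ite (fun v => v.1 = some .mark)
      (.seq (read .main) (.seq (read .main) q)) r)))) x y (t + t' + 20 * (x.size + 1)) := by
  intro v m
  have h₁ := runs_dup x (m := m) (i := []) (o := []) (v := v)
  obtain ⟨v₂, h₂⟩ := h (none, v.2) (x.code ++ m)
  have h₃ := runs_read_main (v := v₂) (i := []) (m := (Datum.ofBool c).code ++ (x.code ++ m))
    (a := []) (b := []) (c := []) (o := [])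
  cases c with
  | true =>
    obtain ⟨v₄, h₄⟩ := hq rfl (some .tick, v₂.2) m
    refine ⟨v₄, (Runs.seq h₁ (.seq h₂ (.seq h₃ (.ite_true rfl
      (.seq runs_read_main (.seq runs_read_main h₄)))))).mono (by omega)⟩
  | false =>
    obtain ⟨v₄, h₄⟩ := hr rfl (some .tick, v₂.2) m
    exact ⟨v₄, (Runs.seq h₁ (.seq h₂ (.seq h₃ (.ite_false rfl h₄)))).mono (by omega)⟩

/-- Read the first symbol of the first component of a pair into the register. -/
def peekFst : StackProg :=
  .seq (read .main) (.seq (read .main) (.seq (write .main) (put .main .mark)))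

theorem runs_peekFst (s : Symbol) (v : Register) (m : List Symbol) :
    Runs peekFst v (conf [] (.mark :: s :: m) [] [] [] []) (some s, v.2)
      (conf [] (.mark :: s :: m) [] [] [] []) 4 :=
  .seq (runs_read_main (m := .mark :: s :: m)) (.seq (runs_read_main (m := s :: m))
    (.seq (runs_write_main (s := s)) runs_put_main))

/-- The first component controls the loop: a code starts with a mark exactly when the tree is not
`nil`, and `peekFst` reads this symbol and restores it. Each round costs `t`, four steps of
`peekFst` and one for the test. -/
theorem Computes.loop {p : StackProg} {k : ℕ} {u w : ℕ → Datum} {t : ℕ}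
    (hu : ∀ i < k, u i ≠ .nil) (hk : u k = .nil)
    (h : ∀ i < k, Computes p (.cons (u i) (w i)) (.cons (u (i + 1)) (w (i + 1))) t) :
    Computes (.seq peekFst (.loop (fun v => v.1 = some .mark) (.seq p peekFst)))
      (.cons (u 0) (w 0)) (.cons (u k) (w k)) (k * (t + 5) + 5) := by
  have key : ∀ n i, i + n = k → ∀ (b : Bool) (m : List Symbol), ∃ v',
      Runs (.loop (fun v => v.1 = some .mark) (.seq p peekFst)) ((u i).code.head?, b)
        (conf [] ((Datum.cons (u i) (w i)).code ++ m) [] [] [] []) v'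
        (conf [] ((Datum.cons (u k) (w k)).code ++ m) [] [] [] []) (n * (t + 5) + 1) := by
    intro n
    induction n with
    | zero =>
      intro i hi b m
      obtain rfl : i = k := by omega
      exact ⟨_, (Runs.loop_false (by rw [hk]; rfl)).mono (by omega)⟩
    | succ n ih =>
      intro i hi b m
      obtain ⟨v₁, h₁⟩ := h i (by omega) ((u i).code.head?, b) m
      obtain ⟨v', h'⟩ := ih (i + 1) (by omega) v₁.2 m
      have hd : ∃ s l, (u (i + 1)).code = s :: l := by
        cases u (i + 1) <;> simp [Datum.code]
      obtain ⟨s, l, hd⟩ := hd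
      have h₂ := runs_peekFst s v₁ (l ++ ((w (i + 1)).code ++ m))
      have e : (Datum.cons (u (i + 1)) (w (i + 1))).code ++ m =
          .mark :: s :: (l ++ ((w (i + 1)).code ++ m)) := by simp [Datum.code, hd]
      rw [e] at h₁ h'
      rw [hd] at h'
      refine ⟨v', (Runs.loop_true ?_ (.seq h₁ h₂) h').mono (by ring_nf; omega)⟩
      have := hu i (by omega)
      cases hui : u i with
      | nil => exact absurd hui this
      | cons x y => simp [Datum.code]
  intro v m
  obtain ⟨v', h'⟩ := key k 0 (by omega) v.2 m
  have hd : ∃ s l, (u 0).code = s :: l := by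
    cases u 0 <;> simp [Datum.code]
  obtain ⟨s, l, hd⟩ := hd
  have h₂ := runs_peekFst s v (l ++ ((w 0).code ++ m))
  have e : (Datum.cons (u 0) (w 0)).code ++ m =
      .mark :: s :: (l ++ ((w 0).code ++ m)) := by simp [Datum.code, hd]
  rw [hd] at h'
  rw [e] at h' ⊢
  exact ⟨v', (Runs.seq h₂ h').mono (by omega)⟩

end SetGame

-- Feasible families of trees

namespace SetGame

/-- One program computes `F a` from `e a`, for all `a`, in time bounded by a power of `B a + 2`. -/
def Feasible {α : Type} (B : α → ℕ) (e F : α → Datum) : Prop :=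
  PowerBounded B (fun a => (e a).size) ∧ PowerBounded B (fun a => (F a).size) ∧
    ∃ (p : StackProg) (t : α → ℕ), PowerBounded B t ∧ ∀ a, Computes p (e a) (F a) (t a)

theorem Datum.size_ofBool_le (b : Bool) : (Datum.ofBool b).size ≤ 3 := by
  cases b <;> simp [Datum.ofBool]

namespace Feasible

variable {α β : Type} {B : α → ℕ} {e F G : α → Datum}

theorem size_le (h : Feasible B e F) : PowerBounded B fun a => (F a).size := h.2.1

theorem refl (he : PowerBounded B fun a => (e a).size) : Feasible B e e :=
  ⟨he, he, skip, fun _ => 1, .const 1, fun _ => computes_skip _⟩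

theorem comp (h : Feasible B e F) (h' : Feasible B F G) : Feasible B e G := by
  obtain ⟨he, _, p, t, ht, hp⟩ := h
  obtain ⟨_, hG, q, t', ht', hq⟩ := h'
  exact ⟨he, hG, _, _, ht.add ht', fun a => (hp a).comp (hq a)⟩

theorem const (he : PowerBounded B fun a => (e a).size) (x : Datum) :
    Feasible B e fun _ => x :=
  ⟨he, .const _, _, _, (((PowerBounded.const 10).mul he).add (.const x.size)).add (.const 4),
    fun a => computes_const (e a) x⟩

theorem pair (h : Feasible B e F) (h' : Feasible B e G) :
    Feasible B e fun a => .cons (F a) (G a) := by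
  obtain ⟨he, hF, p, t, ht, hp⟩ := h
  obtain ⟨_, hG, q, t', ht', hq⟩ := h'
  exact ⟨he, ((hF.add hG).succ).mono fun a => by simp, _, _,
    (ht.add ht').add ((PowerBounded.const 60).mul ((he.add hF).add hG).succ),
    fun a => (hp a).pair (hq a)⟩

theorem fst (h : Feasible B e fun a => .cons (F a) (G a)) : Feasible B e F := by
  have hs := h.size_le
  exact h.comp ⟨hs, hs.mono fun a => by simp; omega, _, _, (PowerBounded.const 30).mul hs,
    fun a => (computes_fst (F a) (G a)).mono (by simp)⟩

theorem snd (h : Feasible B e fun a => .cons (F a) (G a)) : Feasible B e G := by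
  have hs := h.size_le
  exact h.comp ⟨hs, hs.mono fun a => by simp; omega, _, _, (PowerBounded.const 30).mul hs,
    fun a => (computes_snd (F a) (G a)).mono (by simp)⟩

theorem beq (h : Feasible B e F) (h' : Feasible B e G) (c : ∀ a, Decidable (F a = G a)) :
    Feasible B e fun a => .ofBool (decide (F a = G a)) := by
  have hs := (h.pair h').size_le
  exact (h.pair h').comp ⟨hs, (PowerBounded.const 3).mono fun a => Datum.size_ofBool_le _,
    _, _, (PowerBounded.const 30).mul hs,
    fun a => (computes_eqProg (F a) (G a)).mono (by simp)⟩

theorem reindex (h : Feasible B e F) (φ : β → α) :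
    Feasible (fun b => B (φ b)) (fun b => e (φ b)) fun b => F (φ b) := by
  obtain ⟨he, hF, p, t, ht, hp⟩ := h
  exact ⟨he.reindex φ, hF.reindex φ, p, _, ht.reindex φ, fun b => hp (φ b)⟩

/-- Case distinction. The branches need to be feasible only where they are used. -/
theorem cases (c : α → Bool) (hc : Feasible B e fun a => .ofBool (c a))
    (h : Feasible (fun a : {a // c a = true} => B a.1) (fun a => e a.1) fun a => F a.1)
    (h' : Feasible (fun a : {a // c a = false} => B a.1) (fun a => e a.1) fun a => F a.1) :
    Feasible B e F := by
  obtain ⟨he, -, p, t, ht, hp⟩ := hc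
  obtain ⟨-, ⟨d₁, hF₁⟩, q, t₁, ⟨d₂, ht₁⟩, hq⟩ := h
  obtain ⟨-, ⟨d₃, hF₃⟩, r, t₃, ⟨d₄, ht₃⟩, hr⟩ := h'
  have h1 : ∀ a, 1 ≤ B a + 2 := fun a => by omega
  refine ⟨he, ⟨max d₁ d₃, fun a => ?_⟩, _, fun a => t a + (B a + 2) ^ max d₂ d₄ +
    20 * ((e a).size + 1), (ht.add ⟨_, fun _ => le_rfl⟩).add ((PowerBounded.const 20).mul he.succ),
    fun a => (hp a).ite (fun hc => (hq ⟨a, hc⟩).mono ((ht₁ ⟨a, hc⟩).trans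
      (Nat.pow_le_pow_right (h1 a) (le_max_left _ _)))) fun hc => (hr ⟨a, hc⟩).mono
      ((ht₃ ⟨a, hc⟩).trans (Nat.pow_le_pow_right (h1 a) (le_max_right _ _)))⟩
  cases hc : c a with
  | true => exact (hF₁ ⟨a, hc⟩).trans (Nat.pow_le_pow_right (h1 a) (le_max_left _ _))
  | false => exact (hF₃ ⟨a, hc⟩).trans (Nat.pow_le_pow_right (h1 a) (le_max_right _ _))

/-- The rounds are indexed together with `a`, while the bound depends on `a` only. Hence one
exponent serves all rounds, and the total time is this bound multiplied by the number of rounds. -/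
theorem loop {k : α → ℕ} {u w : α → ℕ → Datum} (hk : PowerBounded B k)
    (hu : ∀ a, ∀ i < k a, u a i ≠ .nil) (hu' : ∀ a, u a (k a) = .nil)
    (h₀ : Feasible B e fun a => .cons (u a 0) (w a 0))
    (h : Feasible (fun q : (a : α) × Fin (k a) => B q.1)
      (fun q => .cons (u q.1 q.2) (w q.1 q.2)) fun q => .cons (u q.1 (q.2 + 1)) (w q.1 (q.2 + 1))) :
    Feasible B e fun a => .cons (u a (k a)) (w a (k a)) := by
  refine h₀.comp ?_
  obtain ⟨-, ⟨d₁, hF⟩, p, t, ⟨d₂, ht⟩, hp⟩ := h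
  refine ⟨h₀.size_le, ?_, _, _, (hk.mul ((PowerBounded.const 5).add ⟨d₂, fun _ => le_rfl⟩)).add
    (.const 5), fun a => (Computes.loop (hu a) (hu' a) (t := (B a + 2) ^ d₂)
      fun i hi => (hp ⟨a, i, hi⟩).mono (ht ⟨a, i, hi⟩)).mono (by rw [Nat.add_comm 5])⟩
  -- The final tree is the initial one if there is no round, and otherwise the result of the last
  -- round, whose size is bounded by the feasibility of the body.
  refine PowerBounded.mono (g := fun a => (Datum.cons (u a 0) (w a 0)).size + (B a + 2) ^ d₁)
    (h₀.size_le.add ⟨d₁, fun _ => le_rfl⟩) fun a => ?_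
  rcases Nat.eq_zero_or_pos (k a) with hka | hka
  · simp only [hka]
    omega
  · have h := hF ⟨a, k a - 1, by omega⟩
    simp only [Nat.sub_add_cancel hka] at h
    exact h.trans (Nat.le_add_left _ _)

end Feasible

/-- Types whose elements are written as trees. -/
class Encodes (β : Type) where
  /-- the encoding -/
  enc : β → Datum
  inj : ∀ x y, enc x = enc y → x = y

open Encodes (enc)

instance : Encodes Bool := ⟨Datum.ofBool, fun x y h => by
  cases x <;> cases y <;> simp [Datum.ofBool] at h ⊢⟩

/-- Lists as trees. -/
def encList {β : Type} [Encodes β] : List β → Datum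
  | [] => .nil
  | x :: l => .cons (enc x) (encList l)

theorem encList_inj {β : Type} [Encodes β] : ∀ x y : List β, encList x = encList y → x = y
  | [], [], _ => rfl
  | [], _ :: _, h => by simp [encList] at h
  | _ :: _, [], h => by simp [encList] at h
  | x :: l, y :: k, h => by
    simp only [encList, Datum.cons.injEq] at h
    rw [Encodes.inj _ _ h.1, encList_inj _ _ h.2]

instance {β : Type} [Encodes β] : Encodes (List β) := ⟨encList, encList_inj⟩

instance {β γ : Type} [Encodes β] [Encodes γ] : Encodes (β × γ) :=
  ⟨fun x => .cons (enc x.1) (enc x.2), fun x y h => by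
    simp only [Datum.cons.injEq] at h
    exact Prod.ext (Encodes.inj _ _ h.1) (Encodes.inj _ _ h.2)⟩

theorem enc_bool (b : Bool) : enc b = Datum.ofBool b := rfl

theorem enc_nil {β : Type} [Encodes β] : enc ([] : List β) = .nil := rfl

theorem enc_cons {β : Type} [Encodes β] (x : β) (l : List β) :
    enc (x :: l) = .cons (enc x) (enc l) := rfl

theorem enc_prod {β γ : Type} [Encodes β] [Encodes γ] (x : β × γ) :
    enc x = .cons (enc x.1) (enc x.2) := rfl

theorem size_encList {β : Type} [Encodes β] (l : List β) :
    (enc l).size = (l.map fun x => (enc x).size + 1).sum + 1 := by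
  induction l with
  | nil => rfl
  | cons x l ih => rw [enc_cons, Datum.size_cons, ih, List.map_cons, List.sum_cons]; omega

theorem size_enc_append {β : Type} [Encodes β] (l l' : List β) :
    (enc (l ++ l')).size + 1 = (enc l).size + (enc l').size := by
  simp only [size_encList, List.map_append, List.sum_append]; omega

theorem length_le_size {β : Type} [Encodes β] (l : List β) : l.length ≤ (enc l).size := by
  induction l with
  | nil => simp
  | cons x l ih => rw [enc_cons, Datum.size_cons, List.length_cons]; omega

theorem size_le_of_mem {β : Type} [Encodes β] {l : List β} {x : β} (h : x ∈ l) :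
    (enc x).size ≤ (enc l).size := by
  induction l with
  | nil => simp at h
  | cons y l ih =>
    rw [enc_cons, Datum.size_cons]
    rcases List.mem_cons.1 h with rfl | h
    · omega
    · have := ih h; omega

theorem size_le_of_sublist {β : Type} [Encodes β] {l l' : List β} (h : List.Sublist l l') :
    (enc l).size ≤ (enc l').size := by
  induction h with
  | slnil => exact le_rfl
  | cons x _ ih => rw [enc_cons, Datum.size_cons]; omega
  | cons_cons x _ ih => rw [enc_cons, enc_cons, Datum.size_cons, Datum.size_cons]; omega

theorem size_le_of_forall {β : Type} [Encodes β] {l : List β} {n : ℕ}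
    (h : ∀ x ∈ l, (enc x).size ≤ n) : (enc l).size ≤ l.length * (n + 1) + 1 := by
  induction l with
  | nil => simp [enc_nil]
  | cons x l ih =>
    have h₁ := ih fun y hy => h y (List.mem_cons_of_mem _ hy)
    have h₂ := h x List.mem_cons_self
    rw [enc_cons, Datum.size_cons, List.length_cons, Nat.succ_mul]
    omega

/-- The indices of the steps of a run through the lists `l a`. -/
structure Step {α : Type} {β : α → Type} (l : ∀ a, List (β a)) : Type where
  /-- the index of the list -/
  idx : α
  /-- the elements seen before -/
  pre : List (β idx)
  /-- the current element -/
  elt : β idx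
  /-- the elements that are still to come -/
  post : List (β idx)
  eq : l idx = pre ++ elt :: post

theorem Step.mem {α : Type} {β : α → Type} {l : ∀ a, List (β a)} (q : Step l) :
    q.elt ∈ l q.idx := by
  rw [q.eq]; simp

namespace Feasible

variable {α : Type} {B : α → ℕ} {e : α → Datum} {β γ : α → Type}
  [∀ a, Encodes (β a)] [∀ a, Encodes (γ a)]

/-- The bound on all intermediate accumulators is assumed, because iterating a feasible step may let
sizes explode. The body is analysed over an arbitrary environment from which the current element,
the accumulator and everything feasible outside can be computed; nested folds thus need not know how
the data are arranged. -/
theorem foldl {l : ∀ a, List (β a)} {z : ∀ a, γ a} (f : ∀ a, γ a → β a → γ a)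
    (hl : Feasible B e fun a => enc (l a)) (hz : Feasible B e fun a => enc (z a))
    (hs : ∃ b : α → ℕ, PowerBounded B b ∧ ∀ a pre post, l a = pre ++ post →
      (enc (pre.foldl (f a) (z a))).size ≤ b a)
    (hf : ∀ (env : Step l → Datum)
      (_ : Feasible (fun q => B q.idx) env fun q => enc q.elt)
      (_ : Feasible (fun q => B q.idx) env fun q => enc (q.pre.foldl (f q.idx) (z q.idx)))
      (_ : ∀ {G : α → Datum}, Feasible B e G → Feasible (fun q => B q.idx) env fun q => G q.idx),
      Feasible (fun q => B q.idx) env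
        fun q => enc (f q.idx (q.pre.foldl (f q.idx) (z q.idx)) q.elt)) :
    Feasible B e fun a => enc ((l a).foldl (f a) (z a)) := by
  obtain ⟨b, hb, hbs⟩ := hs
  let acc : ∀ a, ℕ → γ a := fun a i => ((l a).take i).foldl (f a) (z a)
  have hacc : ∀ a i, (enc (acc a i)).size ≤ b a := fun a i =>
    hbs a _ _ (List.take_append_drop i (l a)).symm
  let st : ∀ q : (a : α) × Fin (l a).length, Step l := fun q =>
    ⟨q.1, (l q.1).take q.2, (l q.1)[q.2], (l q.1).drop (q.2 + 1), by simp⟩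
  let env : Step l → Datum := fun q =>
    .cons (enc q.elt) (.cons (enc (q.pre.foldl (f q.idx) (z q.idx))) (e q.idx))
  have henv : Feasible (fun q : Step l => B q.idx) env env := by
    refine refl ((((hl.size_le.add hb).add hl.1).add (.const 2)).reindex (fun q : Step l => q.idx)
      |>.mono fun q => ?_)
    have h₁ := size_le_of_mem q.mem
    have h₂ := hbs _ _ _ q.eq
    simp only [env, Datum.size_cons]
    omega
  have hbody := hf env henv.fst henv.snd.fst fun hG => henv.snd.snd.comp (hG.reindex _)
  have hlen : PowerBounded B fun a => (l a).length := hl.size_le.mono fun a => length_le_size _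
  have hfin := loop (B := B) (e := e) (k := fun a => (l a).length)
    (u := fun a i => enc ((l a).drop i)) (w := fun a i => .cons (enc (acc a i)) (e a))
    hlen (fun a i hi => ?_) (fun a => by simp [enc_nil]) ?_ ?_
  · have h := hfin.snd.fst
    simpa [acc] using h
  · rw [List.drop_eq_getElem_cons hi, enc_cons]; simp
  · simpa [acc] using hl.pair (hz.pair (refl hl.1))
  -- The remaining list is nonempty during a round, so its tree already is the pair of the current
  -- element and the next remaining list.
  · have hst : Feasible (fun q : (a : α) × Fin (l a).length => B q.1)
        (fun q => .cons (enc ((l q.1).drop q.2)) (.cons (enc (acc q.1 q.2)) (e q.1)))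
        (fun q => .cons (.cons (enc (l q.1)[q.2]) (enc ((l q.1).drop (q.2 + 1))))
          (.cons (enc (acc q.1 q.2)) (e q.1))) := by
      have h : ∀ q : (a : α) × Fin (l a).length, enc ((l q.1).drop q.2) =
          .cons (enc (l q.1)[q.2]) (enc ((l q.1).drop (q.2 + 1))) := fun q => by
        rw [← enc_cons]; congr 1; simp
      simp only [h]
      refine refl ((((hl.size_le.add hb).add hl.1).add (.const 2)).reindex
        (fun q : (a : α) × Fin (l a).length => q.1) |>.mono fun q => ?_)
      rw [← h]
      have h₁ := size_le_of_sublist (List.drop_sublist q.2 (l q.1))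
      have h₂ := hacc q.1 q.2
      simp only [Datum.size_cons]
      omega
    have h₁ := (hst.fst.fst.pair hst.snd).comp (hbody.reindex st)
    refine hst.fst.snd.pair (Feasible.pair ?_ hst.snd.snd)
    have e₁ : ∀ q : (a : α) × Fin (l a).length,
        acc q.1 (q.2 + 1) = f q.1 (acc q.1 q.2) (l q.1)[q.2] := fun q => by
      simp only [acc, Fin.getElem_fin]
      rw [← List.take_concat_get' _ _ q.2.2, List.foldl_append]
      simp
    simp only [e₁]
    exact h₁

end Feasible

end SetGame

-- Feasibility of Boolean and list operations

namespace SetGame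

open Encodes (enc)

theorem size_enc_reverse {β : Type} [Encodes β] (l : List β) :
    (enc l.reverse).size = (enc l).size := by
  rw [size_encList, size_encList, List.map_reverse, List.sum_reverse]

namespace Feasible

variable {α : Type} {B : α → ℕ} {e : α → Datum} {β γ : α → Type}
  [∀ a, Encodes (β a)] [∀ a, Encodes (γ a)]

theorem prodMk {x : ∀ a, β a} {y : ∀ a, γ a} (hx : Feasible B e fun a => enc (x a))
    (hy : Feasible B e fun a => enc (y a)) : Feasible B e fun a => enc (x a, y a) := hx.pair hy

theorem prodFst {x : ∀ a, β a × γ a} (hx : Feasible B e fun a => enc (x a)) :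
    Feasible B e fun a => enc (x a).1 := Feasible.fst (G := fun a => enc (x a).2) hx

theorem prodSnd {x : ∀ a, β a × γ a} (hx : Feasible B e fun a => enc (x a)) :
    Feasible B e fun a => enc (x a).2 := Feasible.snd (F := fun a => enc (x a).1) hx

theorem nil (he : PowerBounded B fun a => (e a).size) :
    Feasible B e fun a => enc ([] : List (β a)) := Feasible.const he .nil

theorem cons {x : ∀ a, β a} {l : ∀ a, List (β a)} (hx : Feasible B e fun a => enc (x a))
    (hl : Feasible B e fun a => enc (l a)) : Feasible B e fun a => enc (x a :: l a) := hx.pair hl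

theorem bool (he : PowerBounded B fun a => (e a).size) (b : Bool) :
    Feasible B e fun _ => enc b := Feasible.const he _

theorem eq {x y : ∀ a, β a} [∀ a, Decidable (x a = y a)] (hx : Feasible B e fun a => enc (x a))
    (hy : Feasible B e fun a => enc (y a)) : Feasible B e fun a => enc (decide (x a = y a)) := by
  have h := hx.beq hy fun _ => Classical.propDecidable _
  convert h using 2
  rw [enc_bool]
  congr 1
  rw [Bool.eq_iff_iff]
  simp only [decide_eq_true_eq]
  exact ⟨congrArg _, Encodes.inj _ _⟩

theorem cond {c : α → Bool} {x y : ∀ a, β a} (hc : Feasible B e fun a => enc (c a))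
    (hx : Feasible B e fun a => enc (x a)) (hy : Feasible B e fun a => enc (y a)) :
    Feasible B e fun a => enc (if c a then x a else y a) := by
  refine cases c hc ?_ ?_
  · convert hx.reindex (fun a : {a // c a = true} => a.1) using 3 with a
    simp [a.2]
  · convert hy.reindex (fun a : {a // c a = false} => a.1) using 3 with a
    simp [a.2]

theorem not {c : α → Bool} (hc : Feasible B e fun a => enc (c a)) :
    Feasible B e fun a => enc (!c a) := by
  convert hc.cond (bool hc.1 false) (bool hc.1 true) using 3 with a
  cases c a <;> rfl

theorem and {c d : α → Bool} (hc : Feasible B e fun a => enc (c a))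
    (hd : Feasible B e fun a => enc (d a)) : Feasible B e fun a => enc (c a && d a) := by
  convert hc.cond hd (bool hc.1 false) using 3 with a
  cases c a <;> rfl

theorem or {c d : α → Bool} (hc : Feasible B e fun a => enc (c a))
    (hd : Feasible B e fun a => enc (d a)) : Feasible B e fun a => enc (c a || d a) := by
  convert hc.cond (bool hc.1 true) hd using 3 with a
  cases c a <;> rfl

theorem isEmpty {l : ∀ a, List (β a)} (hl : Feasible B e fun a => enc (l a)) :
    Feasible B e fun a => enc (l a).isEmpty := by
  classical
  convert eq hl (nil hl.1) using 3 with a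
  cases l a <;> simp

/-- The type of the entries may be empty, so there is no default head; the branch that uses the head
is treated over the indices with nonempty list. -/
theorem headElim {l : ∀ a, List (β a)} {z : ∀ a, γ a} {f : ∀ a, β a → γ a}
    (hl : Feasible B e fun a => enc (l a)) (hz : Feasible B e fun a => enc (z a))
    (hf : ∀ (_ : Feasible (fun q : {a // (l a).isEmpty = false} => B q.1) (fun q => e q.1)
        fun q => enc ((l q.1).head (by simpa using q.2)))
      (_ : ∀ {G : α → Datum}, Feasible B e G → Feasible
        (fun q : {a // (l a).isEmpty = false} => B q.1) (fun q => e q.1) fun q => G q.1),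
      Feasible (fun q : {a // (l a).isEmpty = false} => B q.1) (fun q => e q.1)
        fun q => enc (f q.1 ((l q.1).head (by simpa using q.2)))) :
    Feasible B e fun a => enc ((l a).head?.elim (z a) (f a)) := by
  refine cases (fun a => (l a).isEmpty) hl.isEmpty ?_ ?_
  · convert hz.reindex (fun a : {a // (l a).isEmpty = true} => a.1) using 3 with a
    have := a.2
    rw [List.isEmpty_iff] at this
    simp [this]
  · have h := hl.reindex (fun a : {a // (l a).isEmpty = false} => a.1)
    have h' : ∀ a : {a // (l a).isEmpty = false}, enc (l a.1) =
        .cons (enc ((l a.1).head (by simpa using a.2))) (enc (l a.1).tail) := fun a => by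
      rw [← enc_cons, List.cons_head_tail]
    simp only [h'] at h
    convert hf h.fst (fun hG => hG.reindex _) using 3 with a
    rw [List.head?_eq_some_head (by simpa using a.2)]
    rfl

theorem tail {l : ∀ a, List (β a)} (hl : Feasible B e fun a => enc (l a)) :
    Feasible B e fun a => enc (l a).tail := by
  refine cases (fun a => (l a).isEmpty) hl.isEmpty ?_ ?_
  · convert hl.reindex (fun a : {a // (l a).isEmpty = true} => a.1) using 3 with a
    have := a.2
    rw [List.isEmpty_iff] at this
    simp [this]
  · have h := hl.reindex (fun a : {a // (l a).isEmpty = false} => a.1)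
    have h' : ∀ a : {a // (l a).isEmpty = false}, enc (l a.1) =
        .cons (enc ((l a.1).head (by simpa using a.2))) (enc (l a.1).tail) := fun a => by
      rw [← enc_cons, List.cons_head_tail]
    simp only [h'] at h
    exact h.snd

/-- Instantiating the hypothesis on a body with this environment yields a size bound for its values
at all list elements. `map` and `flatMap` need that bound before `foldl` can be applied. -/
theorem exists_env {l : ∀ a, List (β a)} (hl : Feasible B e fun a => enc (l a)) :
    ∃ env : Step l → Datum, Feasible (fun q => B q.idx) env (fun q => enc q.elt) ∧
      ∀ {G : α → Datum}, Feasible B e G → Feasible (fun q => B q.idx) env fun q => G q.idx := by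
  have henv : Feasible (fun q : Step l => B q.idx)
      (fun q => .cons (enc q.elt) (e q.idx)) fun q => .cons (enc q.elt) (e q.idx) := by
    refine refl (((hl.size_le.add hl.1).add (.const 1)).reindex (fun q : Step l => q.idx)
      |>.mono fun q => ?_)
    have h₁ := size_le_of_mem q.mem
    simp only [Datum.size_cons]
    omega
  exact ⟨_, henv.fst, fun hG => henv.snd.comp (hG.reindex _)⟩

theorem reverse {l : ∀ a, List (β a)} (hl : Feasible B e fun a => enc (l a)) :
    Feasible B e fun a => enc (l a).reverse := by
  convert foldl (z := fun a => []) (fun a c x => x :: c) hl (nil hl.1)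
    ⟨_, hl.size_le, fun a pre post h => ?_⟩ (fun env hx hc _ => hx.cons hc) using 3 with a
  · simp
  · simp only [List.foldl_flip_cons_eq_append', List.append_nil]
    rw [size_enc_reverse]
    exact size_le_of_sublist (by rw [h]; exact List.sublist_append_left _ _)

theorem any {l : ∀ a, List (β a)} {p : ∀ a, β a → Bool}
    (hl : Feasible B e fun a => enc (l a))
    (hp : ∀ (env : Step l → Datum)
      (_ : Feasible (fun q => B q.idx) env fun q => enc q.elt)
      (_ : ∀ {G : α → Datum}, Feasible B e G → Feasible (fun q => B q.idx) env fun q => G q.idx),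
      Feasible (fun q => B q.idx) env fun q => enc (p q.idx q.elt)) :
    Feasible B e fun a => enc ((l a).any (p a)) := by
  have h : ∀ a (k : List (β a)) b, k.foldl (fun c x => c || p a x) b = (b || k.any (p a)) := by
    intro a k
    induction k with
    | nil => simp
    | cons x k ih => intro b; rw [List.foldl_cons, ih, List.any_cons, Bool.or_assoc]
  convert foldl (z := fun a => false) (fun a c x => c || p a x) hl (bool hl.1 false)
    ⟨_, .const 3, fun a pre post _ => Datum.size_ofBool_le _⟩
    (fun env hx hc up => hc.or (hp env hx up)) using 3 with a
  rw [h]; simp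

theorem filter {l : ∀ a, List (β a)} {p : ∀ a, β a → Bool}
    (hl : Feasible B e fun a => enc (l a))
    (hp : ∀ (env : Step l → Datum)
      (_ : Feasible (fun q => B q.idx) env fun q => enc q.elt)
      (_ : ∀ {G : α → Datum}, Feasible B e G → Feasible (fun q => B q.idx) env fun q => G q.idx),
      Feasible (fun q => B q.idx) env fun q => enc (p q.idx q.elt)) :
    Feasible B e fun a => enc ((l a).filter (p a)) := by
  have h : ∀ a (k : List (β a)) b, k.foldl (fun c x => if p a x then x :: c else c) b =
      (k.filter (p a)).reverse ++ b := by
    intro a k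
    induction k with
    | nil => simp
    | cons x k ih => intro b; rw [List.foldl_cons, ih, List.filter_cons]; split <;> simp
  convert (foldl (z := fun a => []) (fun a c x => if p a x then x :: c else c) hl (nil hl.1)
    ⟨_, hl.size_le, fun a pre post h' => ?_⟩
    (fun env hx hc up => (hp env hx up).cond (hx.cons hc) hc)).reverse using 3 with a
  · rw [h]; simp
  · rw [h, List.append_nil, size_enc_reverse]
    exact size_le_of_sublist (List.filter_sublist.trans
      (by rw [h']; exact List.sublist_append_left _ _))

theorem map {l : ∀ a, List (β a)} {g : ∀ a, β a → γ a}
    (hl : Feasible B e fun a => enc (l a))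
    (hg : ∀ (env : Step l → Datum)
      (_ : Feasible (fun q => B q.idx) env fun q => enc q.elt)
      (_ : ∀ {G : α → Datum}, Feasible B e G → Feasible (fun q => B q.idx) env fun q => G q.idx),
      Feasible (fun q => B q.idx) env fun q => enc (g q.idx q.elt)) :
    Feasible B e fun a => enc ((l a).map (g a)) := by
  have h : ∀ a (k : List (β a)) b, k.foldl (fun c x => g a x :: c) b =
      (k.map (g a)).reverse ++ b := by
    intro a k
    induction k with
    | nil => simp
    | cons x k ih => intro b; rw [List.foldl_cons, ih]; simp
  obtain ⟨env, hx, up⟩ := hl.exists_env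
  obtain ⟨d, hd⟩ := (hg env hx up).size_le
  convert (foldl (z := fun a => []) (fun a c x => g a x :: c) hl (nil hl.1)
    ⟨fun a => (enc (l a)).size * ((B a + 2) ^ d + 1) + 1,
      (hl.size_le.mul (PowerBounded.succ ⟨d, fun _ => le_rfl⟩)).succ, fun a pre post h' => ?_⟩
    (fun env hx hc up => (hg env hx up).cons hc)).reverse using 3 with a
  · rw [h]; simp
  · rw [h, List.append_nil, size_enc_reverse]
    refine (size_le_of_forall (n := (B a + 2) ^ d) fun y hy => ?_).trans ?_
    · obtain ⟨x, hx, rfl⟩ := List.mem_map.1 hy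
      obtain ⟨s, t, rfl⟩ := List.append_of_mem hx
      exact hd ⟨a, s, x, t ++ post, by simp [h']⟩
    · have h₁ : pre.length ≤ (l a).length := by rw [h']; simp
      have h₂ := length_le_size (l a)
      rw [List.length_map]
      exact Nat.add_le_add_right (Nat.mul_le_mul_right _ (h₁.trans h₂)) 1

theorem append {l l' : ∀ a, List (β a)} (hl : Feasible B e fun a => enc (l a))
    (hl' : Feasible B e fun a => enc (l' a)) : Feasible B e fun a => enc (l a ++ l' a) := by
  convert foldl (fun a c x => x :: c) hl.reverse hl'
    ⟨_, hl.size_le.add hl'.size_le, fun a pre post h => ?_⟩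
    (fun env hx hc _ => hx.cons hc) using 3 with a
  · simp
  · simp only [List.foldl_flip_cons_eq_append']
    have h₁ := size_enc_append pre.reverse (l' a)
    have h₂ := size_enc_reverse (l a)
    rw [size_enc_reverse] at h₁
    have h₃ : (enc pre).size ≤ (enc (l a).reverse).size :=
      size_le_of_sublist (by rw [h]; exact List.sublist_append_left _ _)
    omega

theorem flatMap {l : ∀ a, List (β a)} {g : ∀ a, β a → List (γ a)}
    (hl : Feasible B e fun a => enc (l a))
    (hg : ∀ (env : Step l → Datum)
      (_ : Feasible (fun q => B q.idx) env fun q => enc q.elt)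
      (_ : ∀ {G : α → Datum}, Feasible B e G → Feasible (fun q => B q.idx) env fun q => G q.idx),
      Feasible (fun q => B q.idx) env fun q => enc (g q.idx q.elt)) :
    Feasible B e fun a => enc ((l a).flatMap (g a)) := by
  have h : ∀ a (k : List (β a)) b, k.foldl (fun c x => c ++ g a x) b = b ++ k.flatMap (g a) := by
    intro a k
    induction k with
    | nil => simp
    | cons x k ih => intro b; rw [List.foldl_cons, ih]; simp
  obtain ⟨env, hx, up⟩ := hl.exists_env
  obtain ⟨d, hd⟩ := (hg env hx up).size_le
  have hsize : ∀ a (k : List (β a)), (∀ x ∈ k, (enc (g a x)).size ≤ (B a + 2) ^ d) →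
      (enc (k.flatMap (g a))).size ≤ k.length * (B a + 2) ^ d + 1 := by
    intro a k
    induction k with
    | nil => intro _; simp [enc_nil]
    | cons x k ih =>
      intro hk
      have h₁ := size_enc_append (g a x) (k.flatMap (g a))
      have h₂ := ih fun y hy => hk y (List.mem_cons_of_mem _ hy)
      have h₃ := hk x List.mem_cons_self
      rw [List.flatMap_cons, List.length_cons, Nat.succ_mul]
      omega
  convert foldl (z := fun a => []) (fun a c x => c ++ g a x) hl (nil hl.1)
    ⟨fun a => (enc (l a)).size * (B a + 2) ^ d + 1,
      (hl.size_le.mul ⟨d, fun _ => le_rfl⟩).succ, fun a pre post h' => ?_⟩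
    (fun env hx hc up => hc.append (hg env hx up)) using 3 with a
  · rw [h]; simp
  · rw [h, List.nil_append]
    refine (hsize a pre fun x hx => ?_).trans ?_
    · obtain ⟨s, t, rfl⟩ := List.append_of_mem hx
      exact hd ⟨a, s, x, t ++ post, by simp [h']⟩
    · have h₁ : pre.length ≤ (l a).length := by rw [h']; simp
      have h₂ := length_le_size (l a)
      exact Nat.add_le_add_right (Nat.mul_le_mul_right _ (h₁.trans h₂)) 1

theorem mem {l : ∀ a, List (β a)} {x : ∀ a, β a} [∀ a, Decidable (x a ∈ l a)]
    (hx : Feasible B e fun a => enc (x a)) (hl : Feasible B e fun a => enc (l a)) :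
    Feasible B e fun a => enc (decide (x a ∈ l a)) := by
  classical
  convert any (p := fun a y => decide (y = x a)) hl fun env hy up => hy.eq (up hx) using 3 with a
  rw [Bool.eq_iff_iff]
  simp

/-- Numbers are represented in unary by the lengths of lists, so subtraction and comparison amount
to removing one entry for each entry of another list. -/
theorem dropLength {l : ∀ a, List (β a)} {l' : ∀ a, List (γ a)}
    (hl : Feasible B e fun a => enc (l a)) (hl' : Feasible B e fun a => enc (l' a)) :
    Feasible B e fun a => enc ((l a).drop (l' a).length) := by
  have h : ∀ a (k : List (γ a)) (m : List (β a)),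
      k.foldl (fun c _ => c.tail) m = m.drop k.length := by
    intro a k
    induction k with
    | nil => simp
    | cons x k ih => intro m; rw [List.foldl_cons, ih]; simp
  convert foldl (fun a c x => c.tail) hl' hl ⟨_, hl.size_le, fun a pre post _ => ?_⟩
    fun env hx hc up => hc.tail using 3 with a
  · rw [h]
  · rw [h]
    exact size_le_of_sublist (List.drop_sublist _ _)

theorem length_lt {l : ∀ a, List (β a)} {l' : ∀ a, List (γ a)}
    (hl : Feasible B e fun a => enc (l a)) (hl' : Feasible B e fun a => enc (l' a)) :
    Feasible B e fun a => enc (decide ((l' a).length < (l a).length)) := by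
  convert (hl.dropLength hl').isEmpty.not using 3 with a
  rw [Bool.eq_iff_iff]
  simp

end Feasible

end SetGame

-- Sets as triples with sum zero, and the exchange of fibres

namespace SetGame

variable {n : ℕ}

theorem Card.add_add_self (x : Card n) : x + x + x = 0 := by
  funext i
  have h : ∀ a : Fin 3, a + a + a = 0 := by decide
  exact h (x i)

theorem Card.neg_add_ne_left {x y : Card n} (h : x ≠ y) : -(x + y) ≠ x := fun he => h <| by
  have h₁ := Card.add_add_self x
  have h₂ : x + x + y = 0 := by rw [← neg_eq_iff_add_eq_zero.1 he]; abel
  exact add_left_cancel (h₁.trans h₂.symm)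

/-- Modulo three, three values are all equal or pairwise different exactly when their sum is zero;
this is a finite check in each attribute. -/
theorem isSet_iff {S : Finset (Card n)} :
    IsSet S ↔ ∃ x y, x ≠ y ∧ S = {x, y, -(x + y)} := by
  have h₃ : ∀ a b c : Fin 3, (a = b ∧ b = c ∨ a ≠ b ∧ a ≠ c ∧ b ≠ c) ↔ c = -(a + b) := by decide
  constructor
  · rintro ⟨hc, h⟩
    obtain ⟨x, y, z, hxy, hxz, hyz, rfl⟩ := Finset.card_eq_three.1 hc
    refine ⟨x, y, hxy, ?_⟩
    have : z = -(x + y) := by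
      funext i
      refine (h₃ _ _ _).1 ?_
      rcases h i with h | h
      · exact .inl ⟨h _ (by simp) _ (by simp), h _ (by simp) _ (by simp)⟩
      · exact .inr ⟨h _ (by simp) _ (by simp) hxy, h _ (by simp) _ (by simp) hxz,
          h _ (by simp) _ (by simp) hyz⟩
    rw [this]
  · rintro ⟨x, y, hxy, rfl⟩
    refine ⟨Finset.card_eq_three.2 ⟨x, y, _, hxy, (Card.neg_add_ne_left hxy).symm, ?_, rfl⟩, ?_⟩
    · rw [add_comm]
      exact (Card.neg_add_ne_left hxy.symm).symm
    · intro i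
      have h := (h₃ (x i) (y i) ((-(x + y)) i)).2 rfl
      rcases h with ⟨h₁, h₂⟩ | ⟨h₁, h₂, h₄⟩
      · left
        simp only [Finset.mem_insert, Finset.mem_singleton]
        rintro _ (rfl | rfl | rfl) _ (rfl | rfl | rfl) <;>
          first
            | rfl
            | exact h₁
            | exact h₂
            | exact h₁.symm
            | exact h₂.symm
            | exact h₁.trans h₂
            | exact (h₁.trans h₂).symm
      · right
        simp only [Finset.mem_insert, Finset.mem_singleton]
        rintro _ (rfl | rfl | rfl) _ (rfl | rfl | rfl) <;>
          first
            | exact fun h => absurd rfl h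
            | exact fun _ => h₁
            | exact fun _ => h₂
            | exact fun _ => h₄
            | exact fun _ => h₁.symm
            | exact fun _ => h₂.symm
            | exact fun _ => h₄.symm

/-- Only Sets on the table matter, so `φ` need not respect Sets elsewhere. This generality is
essential, as the exchange of fibres is not affine. -/
theorem wins_of_injOn {φ : Card n → Card n} (hφ : Function.Injective φ) :
    ∀ (k : ℕ) (C : Finset (Card n)), (∀ S ⊆ C, IsSet S → IsSet (S.image φ)) →
      (∀ S ⊆ C, IsSet (S.image φ) → IsSet S) →
      (MoverWinsWithin k C → MoverWinsWithin k (C.image φ)) ∧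
      (MoverLosesWithin k C → MoverLosesWithin k (C.image φ))
  | 0, C, _, h' => by
    refine ⟨fun h => by simp [MoverWinsWithin] at h, fun h => ?_⟩
    simp only [MoverLosesWithin] at h ⊢
    intro S hS hs
    obtain ⟨S', hS', rfl⟩ := Finset.subset_image_iff.1 hS
    exact h S' hS' (h' S' hS' hs)
  | k + 1, C, h, h' => by
    have ih : ∀ S : Finset (Card n), _ := fun S => wins_of_injOn hφ k (C \ S)
      (fun S hS => h S (hS.trans Finset.sdiff_subset))
      (fun S hS => h' S (hS.trans Finset.sdiff_subset))
    simp only [MoverLosesWithin, MoverWinsWithin]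
    constructor
    · rintro ⟨S, hS, hs, hw⟩
      refine ⟨S.image φ, Finset.image_subset_image hS, h S hS hs, ?_⟩
      rw [← Finset.image_sdiff _ _ hφ]
      exact (ih S).2 hw
    · intro hw S hS hs
      obtain ⟨S', hS', rfl⟩ := Finset.subset_image_iff.1 hS
      rw [← Finset.image_sdiff _ _ hφ]
      exact (ih S').1 (hw S' hS' (h' S' hS' hs))

section Swap

variable {Q : Type} [AddCommGroup Q] (f : Card n →+ Q)

open Classical in
/-- The map that exchanges the fibres of `x` and `y` under `f`, and those of `-x` and `-y`, by
translations. -/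
noncomputable def swapFibres (x y c : Card n) : Card n :=
  if f c = f x then c - x + y else if f c = -f x then c + x - y
  else if f c = f y then c - y + x else if f c = -f y then c + y - x else c

variable {f}

/-- Every value of `f` is annihilated by three, so a value equal to its negative is zero. Hence the
fibres of `x` and `-x` are disjoint when `f x ≠ 0`. -/
theorem neg_ne_self_of_map {x : Card n} (hx : f x ≠ 0) : -f x ≠ f x := fun h => hx <| by
  have h₁ : f x + f x + f x = 0 := by rw [← map_add, ← map_add, Card.add_add_self, map_zero]
  have h₂ : f x + f x = 0 := neg_eq_iff_add_eq_zero.1 h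
  rwa [h₂, zero_add] at h₁

variable {x y : Card n}

theorem swapFibres_of_eq_left {c : Card n} (h : f c = f x) :
    swapFibres f x y c = c - x + y := by simp [swapFibres, h]

theorem swapFibres_of_eq_neg_left (hx : f x ≠ 0) {c : Card n} (h : f c = -f x) :
    swapFibres f x y c = c + x - y := by
  simp [swapFibres, h, neg_ne_self_of_map hx]

theorem swapFibres_of_eq_right (hxy : f y ≠ f x) (hxy' : f y ≠ -f x) {c : Card n} (h : f c = f y) :
    swapFibres f x y c = c - y + x := by
  simp [swapFibres, h, hxy, hxy']

theorem swapFibres_of_eq_neg_right (hy : f y ≠ 0) (hxy : f y ≠ f x) (hxy' : f y ≠ -f x)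
    {c : Card n} (h : f c = -f y) :
    swapFibres f x y c = c + y - x := by
  have h₁ : -f y ≠ f x := fun h => hxy' (by rw [← h, neg_neg])
  simp [swapFibres, h, neg_ne_self_of_map hy, h₁, hxy]

theorem swapFibres_of_ne {c : Card n} (h₁ : f c ≠ f x) (h₂ : f c ≠ -f x) (h₃ : f c ≠ f y)
    (h₄ : f c ≠ -f y) : swapFibres f x y c = c := by
  simp [swapFibres, h₁, h₂, h₃, h₄]

theorem swapFibres_swapFibres (hx : f x ≠ 0) (hy : f y ≠ 0) (hxy : f y ≠ f x) (hxy' : f y ≠ -f x)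
    (c : Card n) : swapFibres f x y (swapFibres f x y c) = c := by
  by_cases h₁ : f c = f x
  · rw [swapFibres_of_eq_left h₁, swapFibres_of_eq_right hxy hxy' (by simp [h₁])]; abel
  by_cases h₂ : f c = -f x
  · rw [swapFibres_of_eq_neg_left hx h₂,
      swapFibres_of_eq_neg_right hy hxy hxy' (by simp [h₂])]; abel
  by_cases h₃ : f c = f y
  · rw [swapFibres_of_eq_right hxy hxy' h₃, swapFibres_of_eq_left (by simp [h₃])]; abel
  by_cases h₄ : f c = -f y
  · rw [swapFibres_of_eq_neg_right hy hxy hxy' h₄,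
      swapFibres_of_eq_neg_left hx (by simp [h₄])]; abel
  rw [swapFibres_of_ne h₁ h₂ h₃ h₄, swapFibres_of_ne h₁ h₂ h₃ h₄]

/-- This takes the place of linearity. Opposite fibres are translated by opposite vectors, so the
completion of a card and a kernel card to a Set commutes with the exchange. -/
theorem swapFibres_neg_add (hx : f x ≠ 0) (hy : f y ≠ 0) (hxy : f y ≠ f x) (hxy' : f y ≠ -f x)
    (c : Card n) {h : Card n} (hh : f h = 0) :
    swapFibres f x y (-(c + h)) = -(swapFibres f x y c + h) := by
  have e : f (-(c + h)) = -f c := by simp [hh]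
  by_cases h₁ : f c = f x
  · rw [swapFibres_of_eq_left h₁, swapFibres_of_eq_neg_left hx (by rw [e, h₁])]; abel
  by_cases h₂ : f c = -f x
  · rw [swapFibres_of_eq_neg_left hx h₂, swapFibres_of_eq_left (by rw [e, h₂, neg_neg])]; abel
  by_cases h₃ : f c = f y
  · rw [swapFibres_of_eq_right hxy hxy' h₃,
      swapFibres_of_eq_neg_right hy hxy hxy' (by rw [e, h₃])]; abel
  by_cases h₄ : f c = -f y
  · rw [swapFibres_of_eq_neg_right hy hxy hxy' h₄,
      swapFibres_of_eq_right hxy hxy' (by rw [e, h₄, neg_neg])]; abel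
  rw [swapFibres_of_ne h₁ h₂ h₃ h₄, swapFibres_of_ne]
  · rwa [e, Ne, neg_eq_iff_eq_neg]
  · rwa [e, Ne, neg_inj]
  · rwa [e, Ne, neg_eq_iff_eq_neg]
  · rwa [e, Ne, neg_inj]

theorem swapFibres_of_map_eq_zero (hx : f x ≠ 0) (hy : f y ≠ 0)
    {h : Card n} (hh : f h = 0) : swapFibres f x y h = h := by
  apply swapFibres_of_ne <;> rw [hh]
  · exact hx.symm
  · exact (neg_ne_zero.2 hx).symm
  · exact hy.symm
  · exact (neg_ne_zero.2 hy).symm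

theorem isSet_image_swapFibres (hx : f x ≠ 0) (hy : f y ≠ 0) (hxy : f y ≠ f x) (hxy' : f y ≠ -f x)
    {S : Finset (Card n)} (hS : IsSet S) (h : ∃ c ∈ S, f c = 0) :
    IsSet (S.image (swapFibres f x y)) := by
  have hinj : Function.Injective (swapFibres f x y) :=
    Function.LeftInverse.injective (swapFibres_swapFibres hx hy hxy hxy')
  obtain ⟨c, hc, hc0⟩ := h
  have : ∃ d, d ≠ c ∧ S = {d, c, -(d + c)} := by
    obtain ⟨a, b, hab, rfl⟩ := isSet_iff.1 hS
    simp only [Finset.mem_insert, Finset.mem_singleton] at hc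
    rcases hc with rfl | rfl | rfl
    · exact ⟨b, hab.symm, by rw [add_comm b c, Finset.insert_comm]⟩
    · exact ⟨a, hab, rfl⟩
    · refine ⟨a, (Card.neg_add_ne_left hab).symm, ?_⟩
      rw [show -(a + -(a + b)) = b by abel, Finset.pair_comm]
  obtain ⟨d, hdc, rfl⟩ := this
  refine isSet_iff.2 ⟨swapFibres f x y d, c, fun he => hdc ?_, ?_⟩
  · rw [← swapFibres_of_map_eq_zero hx hy hc0] at he
    exact hinj he
  · rw [Finset.image_insert, Finset.image_insert, Finset.image_singleton,
      swapFibres_neg_add hx hy hxy hxy' d hc0, swapFibres_of_map_eq_zero hx hy hc0]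

end Swap

-- Redundant orbits can be deleted

section Orbit

variable {Q : Type} [AddCommGroup Q] (f : Card n →+ Q)

/-- The cards `c` and `d` have the same or the opposite value under `f`. -/
def SameOrbit (c d : Card n) : Prop := f d = f c ∨ f d = -f c

/-- The cards of `C` in the orbits of `x` and of `y` correspond to each other. -/
def Similar (C : Finset (Card n)) (x y : Card n) : Prop :=
  ∀ v, f v = 0 → (x + v ∈ C ↔ y + v ∈ C) ∧ (-x + v ∈ C ↔ -y + v ∈ C)

variable {f}

/-- Similarity says precisely that the translations between the exchanged fibres respect membership
in `C`; equality follows because the exchange is an involution. -/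
theorem image_swapFibres_eq {C : Finset (Card n)} {x y : Card n} (hx : f x ≠ 0) (hy : f y ≠ 0)
    (hxy : ¬ SameOrbit f x y) (h : Similar f C x y) : C.image (swapFibres f x y) = C := by
  obtain ⟨hxy, hxy'⟩ := not_or.1 hxy
  have key : ∀ c ∈ C, swapFibres f x y c ∈ C := by
    intro c hc
    by_cases h₁ : f c = f x
    · rw [swapFibres_of_eq_left h₁, show c - x + y = y + (c - x) by abel]
      refine (h (c - x) (by simp [h₁])).1.1 ?_
      rwa [add_sub_cancel]
    by_cases h₂ : f c = -f x
    · rw [swapFibres_of_eq_neg_left hx h₂, show c + x - y = -y + (c + x) by abel]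
      refine (h (c + x) (by simp [h₂])).2.1 ?_
      rwa [show -x + (c + x) = c by abel]
    by_cases h₃ : f c = f y
    · rw [swapFibres_of_eq_right hxy hxy' h₃, show c - y + x = x + (c - y) by abel]
      refine (h (c - y) (by simp [h₃])).1.2 ?_
      rwa [add_sub_cancel]
    by_cases h₄ : f c = -f y
    · rw [swapFibres_of_eq_neg_right hy hxy hxy' h₄, show c + y - x = -x + (c + y) by abel]
      refine (h (c + y) (by simp [h₄])).2.2 ?_
      rwa [show -y + (c + y) = c by abel]
    rwa [swapFibres_of_ne h₁ h₂ h₃ h₄]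
  apply Finset.Subset.antisymm
  · exact Finset.image_subset_iff.2 key
  · intro c hc
    exact Finset.mem_image.2 ⟨_, key c hc, swapFibres_swapFibres hx hy hxy hxy' c⟩

theorem SameOrbit.refl (c : Card n) : SameOrbit f c c := .inl rfl

theorem SameOrbit.symm {c d : Card n} : SameOrbit f c d → SameOrbit f d c
  | .inl h => .inl h.symm
  | .inr h => .inr (by rw [h, neg_neg])

theorem SameOrbit.trans {c d e : Card n} : SameOrbit f c d → SameOrbit f d e → SameOrbit f c e
  | .inl h, .inl h' => .inl (h'.trans h)
  | .inl h, .inr h' => .inr (by rw [h', h])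
  | .inr h, .inl h' => .inr (h'.trans h)
  | .inr h, .inr h' => .inl (by rw [h', h, neg_neg])

theorem SameOrbit.map_ne_zero {c d : Card n} (hc : f c ≠ 0) : SameOrbit f c d → f d ≠ 0
  | .inl h => h ▸ hc
  | .inr h => by rw [h]; exact neg_ne_zero.2 hc

/-- If three values have sum zero and one of them vanishes, the other two are opposite. A Set that
meets the kernel therefore touches at most one orbit outside it. -/
theorem IsSet.exists_sameOrbit {S : Finset (Card n)} (hS : IsSet S) (h : ∃ c ∈ S, f c = 0) :
    ∃ d ∈ S, ∀ s ∈ S, f s = 0 ∨ SameOrbit f d s := by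
  obtain ⟨c, hc, hc0⟩ := h
  obtain ⟨a, b, hab, rfl⟩ := isSet_iff.1 hS
  simp only [Finset.mem_insert, Finset.mem_singleton] at hc
  simp only [Finset.mem_insert, Finset.mem_singleton, forall_eq_or_imp, forall_eq,
    exists_eq_or_imp, exists_eq_left]
  rcases hc with rfl | rfl | rfl
  · exact .inr (.inl ⟨.inl hc0, .inr (.refl _), .inr (.inr (by simp [hc0]))⟩)
  · exact .inl ⟨.inr (.refl _), .inl hc0, .inr (.inr (by simp [hc0]))⟩
  · refine .inl ⟨.inr (.refl _), .inr (.inr ?_), .inl hc0⟩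
    rw [map_neg, map_add, neg_eq_zero] at hc0
    exact eq_neg_of_add_eq_zero_right hc0

variable (f) in
/-- Every Set among the cards `C` contains a card from the kernel of `f`. -/
def Meets (C : Finset (Card n)) : Prop := ∀ S ⊆ C, IsSet S → ∃ c ∈ S, f c = 0

variable (f) in
/-- There are `k` further orbits in which the cards of `C` correspond to those in the orbit
of `x`. -/
def Copies (k : ℕ) (C : Finset (Card n)) (x : Card n) : Prop :=
  ∃ X : Finset (Card n), k ≤ X.card ∧
    (∀ y ∈ X, f y ≠ 0 ∧ ¬ SameOrbit f x y ∧ Similar f C x y) ∧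
    ∀ y ∈ X, ∀ z ∈ X, y ≠ z → ¬ SameOrbit f y z

open Classical in
variable (f) in
/-- The cards outside the orbit of `x`. -/
noncomputable def deleteOrbit (C : Finset (Card n)) (x : Card n) : Finset (Card n) :=
  C.filter fun c => ¬ SameOrbit f x c

theorem mem_deleteOrbit {C : Finset (Card n)} {x c : Card n} :
    c ∈ deleteOrbit f C x ↔ c ∈ C ∧ ¬ SameOrbit f x c := by
  simp [deleteOrbit]

theorem deleteOrbit_sdiff (C S : Finset (Card n)) (x : Card n) :
    deleteOrbit f (C \ S) x = deleteOrbit f C x \ S := by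
  ext c
  simp only [mem_deleteOrbit, Finset.mem_sdiff]
  tauto

theorem Meets.mono {C D : Finset (Card n)} (h : Meets f C) (hD : D ⊆ C) : Meets f D :=
  fun S hS => h S (hS.trans hD)

/-- The removed Set touches at most one orbit outside the kernel, so at most one copy is spoiled.
The orbit of `x` itself is untouched, and the remaining copies still correspond to it. -/
theorem Copies.sdiff {k : ℕ} {C S : Finset (Card n)} {x : Card n} (h : Copies f (k + 1) C x)
    (hS : IsSet S) (hS0 : ∃ c ∈ S, f c = 0) (hSx : ∀ s ∈ S, ¬ SameOrbit f x s) :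
    Copies f k (C \ S) x := by
  classical
  obtain ⟨X, hX, h₁, h₂⟩ := h
  obtain ⟨d, -, hd⟩ := hS.exists_sameOrbit hS0
  have hsim : ∀ y ∈ X, ¬ SameOrbit f d y → Similar f (C \ S) x y := by
    intro y hy hdy v hv
    have hx₁ : x + v ∉ S := fun h => hSx _ h (.inl (by simp [hv]))
    have hx₂ : -x + v ∉ S := fun h => hSx _ h (.inr (by simp [hv]))
    have hy₁ : y + v ∉ S := fun h => by
      rcases hd _ h with h | h
      · exact (h₁ y hy).1 (by simpa [hv] using h)
      · exact hdy (h.trans (.inl (by simp [hv])))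
    have hy₂ : -y + v ∉ S := fun h => by
      rcases hd _ h with h | h
      · exact (h₁ y hy).1 (by simpa [hv] using h)
      · exact hdy (h.trans (.inr (by simp [hv])))
    simpa [hx₁, hx₂, hy₁, hy₂] using (h₁ y hy).2.2 v hv
  by_cases hX' : ∃ y ∈ X, SameOrbit f d y
  · obtain ⟨y, hy, hdy⟩ := hX'
    refine ⟨X.erase y, by rw [Finset.card_erase_of_mem hy]; omega, fun z hz => ?_,
      fun z hz w hw => h₂ z (Finset.mem_of_mem_erase hz) w (Finset.mem_of_mem_erase hw)⟩
    have hzX := Finset.mem_of_mem_erase hz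
    exact ⟨(h₁ z hzX).1, (h₁ z hzX).2.1, hsim z hzX fun hdz =>
      h₂ y hy z hzX (Finset.ne_of_mem_erase hz).symm (hdy.symm.trans hdz)⟩
  · push Not at hX'
    exact ⟨X, by omega, fun y hy => ⟨(h₁ y hy).1, (h₁ y hy).2.1, hsim y hy (hX' y hy)⟩, h₂⟩

/-- A Set that touches the orbit of `x` lies in the kernel and this orbit. The exchange with the
orbit of `y` carries it away from there and maps `C` to itself, so the two resulting positions are
isomorphic. -/
theorem exists_mirror {C S : Finset (Card n)} {x y : Card n} (hx : f x ≠ 0) (hC : Meets f C)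
    (hy : f y ≠ 0) (hxy : ¬ SameOrbit f x y) (h : Similar f C x y) (hSC : S ⊆ C) (hS : IsSet S) :
    ∃ S' ⊆ C, IsSet S' ∧ (∀ s ∈ S', ¬ SameOrbit f x s) ∧
      ∀ k, (MoverWinsWithin k (C \ S) ↔ MoverWinsWithin k (C \ S')) ∧
        (MoverLosesWithin k (C \ S) ↔ MoverLosesWithin k (C \ S')) := by
  by_cases hSx : ∀ s ∈ S, ¬ SameOrbit f x s
  · exact ⟨S, hSC, hS, hSx, fun k => ⟨.rfl, .rfl⟩⟩
  push Not at hSx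
  obtain ⟨s, hs, hxs⟩ := hSx
  obtain ⟨d, -, hd⟩ := hS.exists_sameOrbit (hC S hSC hS)
  have hxd : SameOrbit f x d := hxs.trans (((hd s hs).resolve_left (hxs.map_ne_zero hx)).symm)
  have himg := image_swapFibres_eq hx hy hxy h
  obtain ⟨hxy, hxy'⟩ := not_or.1 hxy
  have hinv := swapFibres_swapFibres hx hy hxy hxy'
  have hinj : Function.Injective (swapFibres f x y) := Function.LeftInverse.injective hinv
  have hinv' : ∀ D : Finset (Card n), (D.image (swapFibres f x y)).image (swapFibres f x y) = D :=
    fun D => by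
      rw [Finset.image_image]
      exact (Finset.image_congr fun c _ => hinv c).trans Finset.image_id
  have hsub : ∀ D ⊆ C, D.image (swapFibres f x y) ⊆ C := fun D hD => by
    rw [← himg]; exact Finset.image_subset_image hD
  have hset : ∀ D ⊆ C, IsSet D → IsSet (D.image (swapFibres f x y)) := fun D hD hs =>
    isSet_image_swapFibres hx hy hxy hxy' hs (hC D hD hs)
  have hwin : ∀ k, ∀ D ⊆ C, _ := fun k D hD => wins_of_injOn hinj k D
    (fun T hT => hset T (hT.trans hD)) (fun T hT hs => by
      rw [← hinv' T]; exact hset _ (hsub T (hT.trans hD)) hs)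
  have e : (C \ S).image (swapFibres f x y) = C \ S.image (swapFibres f x y) := by
    rw [Finset.image_sdiff _ _ hinj, himg]
  have e' : (C \ S.image (swapFibres f x y)).image (swapFibres f x y) = C \ S := by
    rw [← e, hinv']
  refine ⟨S.image (swapFibres f x y), hsub S hSC, hset S hSC hS, fun t ht => ?_, fun k => ?_⟩
  · obtain ⟨s, hs, rfl⟩ := Finset.mem_image.1 ht
    rcases hd s hs with h0 | h0
    · rw [swapFibres_of_map_eq_zero hx hy h0]
      exact fun h => h.map_ne_zero hx h0
    · rcases hxd.trans h0 with h0 | h0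
      · rw [swapFibres_of_eq_left h0]
        rintro (h | h)
        · exact hxy (by simpa [h0] using h)
        · exact hxy' (by simpa [h0] using h)
      · rw [swapFibres_of_eq_neg_left hx h0]
        rintro (h | h)
        · exact hxy' (by rw [← h]; simp [h0])
        · exact hxy (by simpa [h0] using h)
  · have h₁ := hwin k (C \ S) Finset.sdiff_subset
    have h₂ := hwin k (C \ S.image (swapFibres f x y)) Finset.sdiff_subset
    rw [e] at h₁
    rw [e'] at h₂
    exact ⟨⟨h₁.1, h₂.1⟩, ⟨h₁.2, h₂.2⟩⟩

/-- Induction on the rounds: a move in the orbit of `x` is replaced by its mirror image, after which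
the move is legal in both games. Of the `k + 1` copies each round spoils at most one, and one must
survive to the end so that a last Set in the orbit of `x` still has a mirror image. -/
theorem deleteOrbit_iff : ∀ (k : ℕ) (C : Finset (Card n)) (x : Card n), f x ≠ 0 → Meets f C →
    Copies f (k + 1) C x → (MoverWinsWithin k C ↔ MoverWinsWithin k (deleteOrbit f C x)) ∧
      (MoverLosesWithin k C ↔ MoverLosesWithin k (deleteOrbit f C x)) := by
  intro k
  induction k with
  | zero =>
    intro C x hx hC hcop
    refine ⟨by simp only [MoverWinsWithin], ?_⟩
    simp only [MoverLosesWithin]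
    refine ⟨fun h S hS => h S (hS.trans fun c hc => (mem_deleteOrbit.1 hc).1), fun h S hSC hS => ?_⟩
    obtain ⟨X, hX, h₁, -⟩ := hcop
    obtain ⟨y, hy⟩ := Finset.card_pos.1 (lt_of_lt_of_le (Nat.succ_pos _) hX)
    obtain ⟨S', hSC', hS', hSx, -⟩ := exists_mirror hx hC (h₁ y hy).1 (h₁ y hy).2.1
      (h₁ y hy).2.2 hSC hS
    exact h S' (fun s hs => mem_deleteOrbit.2 ⟨hSC' hs, hSx s hs⟩) hS'
  | succ k ih =>
    intro C x hx hC hcop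
    have ih' : ∀ S ⊆ C, IsSet S → (∀ s ∈ S, ¬ SameOrbit f x s) → _ := fun S hSC hS hSx =>
      ih (C \ S) x hx (hC.mono Finset.sdiff_subset) (hcop.sdiff hS (hC S hSC hS) hSx)
    simp only [deleteOrbit_sdiff] at ih'
    obtain ⟨X, hX, h₁, -⟩ := hcop
    obtain ⟨y, hy⟩ := Finset.card_pos.1 (lt_of_lt_of_le (Nat.succ_pos _) hX)
    have hmir : ∀ S ⊆ C, IsSet S → _ := fun S hSC hS =>
      exists_mirror hx hC (h₁ y hy).1 (h₁ y hy).2.1 (h₁ y hy).2.2 hSC hS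
    have hdel : ∀ S : Finset (Card n), S ⊆ deleteOrbit f C x ↔
        S ⊆ C ∧ ∀ s ∈ S, ¬ SameOrbit f x s := fun S => by
      simp only [Finset.subset_iff, mem_deleteOrbit, forall_and]
    simp only [MoverLosesWithin, MoverWinsWithin]
    constructor
    · constructor
      · rintro ⟨S, hSC, hS, hw⟩
        obtain ⟨S', hSC', hS', hSx, hk⟩ := hmir S hSC hS
        exact ⟨S', (hdel S').2 ⟨hSC', hSx⟩, hS', (ih' S' hSC' hS' hSx).2.1 ((hk k).2.1 hw)⟩
      · rintro ⟨S, hSC, hS, hw⟩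
        obtain ⟨hSC, hSx⟩ := (hdel S).1 hSC
        exact ⟨S, hSC, hS, (ih' S hSC hS hSx).2.2 hw⟩
    · constructor
      · intro h S hSC hS
        obtain ⟨hSC, hSx⟩ := (hdel S).1 hSC
        exact (ih' S hSC hS hSx).1.1 (h S hSC hS)
      · intro h S hSC hS
        obtain ⟨S', hSC', hS', hSx, hk⟩ := hmir S hSC hS
        exact (hk k).1.2 ((ih' S' hSC' hS' hSx).1.2 (h S' ((hdel S').2 ⟨hSC', hSx⟩) hS'))

end Orbit

end SetGame

-- Moves on lists, greedy removal of Sets and spans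

namespace SetGame

variable {n : ℕ}

/-- The Sets among the cards of a list, each given by two of its cards. -/
def moves (C : List (Card n)) : List (Card n × Card n) :=
  C.flatMap fun x =>
    (C.filter fun y => !decide (x = y) && decide (-(x + y) ∈ C)).map fun y => (x, y)

/-- The cards that are left when a Set is removed. -/
def remove (C : List (Card n)) (p : Card n × Card n) : List (Card n) :=
  C.filter fun c => !(decide (c = p.1) || decide (c = p.2) || decide (c = -(p.1 + p.2)))

theorem mem_moves {C : List (Card n)} {p : Card n × Card n} :
    p ∈ moves C ↔ (p.1 ∈ C ∧ p.2 ∈ C ∧ -(p.1 + p.2) ∈ C) ∧ p.1 ≠ p.2 := by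
  obtain ⟨x, y⟩ := p
  simp only [moves, List.mem_flatMap, List.mem_map, List.mem_filter, Prod.mk.injEq,
    Bool.and_eq_true, Bool.not_eq_true', decide_eq_false_iff_not, decide_eq_true_eq]
  constructor
  · rintro ⟨a, ha, b, ⟨hb, hab, hc⟩, rfl, rfl⟩
    exact ⟨⟨ha, hb, hc⟩, hab⟩
  · rintro ⟨⟨ha, hb, hc⟩, hab⟩
    exact ⟨x, ha, y, ⟨hb, hab, hc⟩, rfl, rfl⟩

theorem toFinset_remove (C : List (Card n)) (p : Card n × Card n) :
    (remove C p).toFinset = C.toFinset \ {p.1, p.2, -(p.1 + p.2)} := by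
  ext c
  simp [remove]
  tauto

theorem exists_isSet_iff {C : List (Card n)} {P : Finset (Card n) → Prop} :
    (∃ S ⊆ C.toFinset, IsSet S ∧ P S) ↔ ∃ p ∈ moves C, P {p.1, p.2, -(p.1 + p.2)} := by
  constructor
  · rintro ⟨S, hSC, hS, hP⟩
    obtain ⟨x, y, hxy, rfl⟩ := isSet_iff.1 hS
    refine ⟨(x, y), mem_moves.2 ⟨?_, hxy⟩, hP⟩
    simpa [Finset.insert_subset_iff] using hSC
  · rintro ⟨p, hp, hP⟩
    obtain ⟨h, hp⟩ := mem_moves.1 hp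
    exact ⟨_, by simpa [Finset.insert_subset_iff] using h, isSet_iff.2 ⟨_, _, hp, rfl⟩, hP⟩

theorem forall_isSet_iff {C : List (Card n)} {P : Finset (Card n) → Prop} :
    (∀ S ⊆ C.toFinset, IsSet S → P S) ↔ ∀ p ∈ moves C, P {p.1, p.2, -(p.1 + p.2)} := by
  have h := not_congr (exists_isSet_iff (C := C) (P := fun S => ¬ P S))
  push Not at h
  exact h

theorem moverLosesWithin_zero_iff {C : List (Card n)} :
    MoverLosesWithin 0 C.toFinset ↔ moves C = [] := by
  rw [MoverLosesWithin, List.eq_nil_iff_forall_not_mem]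
  exact forall_isSet_iff

theorem moverWinsWithin_succ_iff {k : ℕ} {C : List (Card n)} :
    MoverWinsWithin (k + 1) C.toFinset ↔
      ∃ p ∈ moves C, MoverLosesWithin k (remove C p).toFinset := by
  rw [MoverWinsWithin, exists_isSet_iff]
  simp only [toFinset_remove]

theorem moverLosesWithin_succ_iff {k : ℕ} {C : List (Card n)} :
    MoverLosesWithin (k + 1) C.toFinset ↔
      ∀ p ∈ moves C, MoverWinsWithin k (remove C p).toFinset := by
  rw [MoverLosesWithin, forall_isSet_iff]
  simp only [toFinset_remove]

/-- If the game ends after few rounds, then few cards meet all Sets. -/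
theorem exists_hitting : ∀ (k : ℕ) (C : Finset (Card n)),
    MoverWinsWithin k C ∨ MoverLosesWithin k C →
      ∃ P : Finset (Card n), P.card ≤ 3 * k ∧ ∀ S ⊆ C \ P, ¬ IsSet S
  | 0, C, h => by
    refine ⟨∅, by simp, ?_⟩
    simpa [MoverWinsWithin, MoverLosesWithin] using h
  | k + 1, C, h => by
    have key : ∀ S : Finset (Card n), IsSet S →
        MoverWinsWithin k (C \ S) ∨ MoverLosesWithin k (C \ S) →
        ∃ P : Finset (Card n), P.card ≤ 3 * (k + 1) ∧ ∀ S ⊆ C \ P, ¬ IsSet S := by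
      intro S hS h
      obtain ⟨P, hP, h⟩ := exists_hitting k _ h
      refine ⟨S ∪ P, ?_, fun T hT => h T ?_⟩
      · have := Finset.card_union_le S P
        have := hS.1
        omega
      · rwa [sdiff_sdiff]
    rw [MoverWinsWithin, MoverLosesWithin] at h
    rcases h with ⟨S, -, hS, h⟩ | h
    · exact key S hS (.inr h)
    -- A mover who loses within the given rounds may remove any Set, as every continuation is won by
    -- the opponent in the remaining rounds.
    · by_cases hC : ∃ S ⊆ C, IsSet S
      · obtain ⟨S, hSC, hS⟩ := hC
        exact key S hS (.inl (h S hSC hS))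
      · push Not at hC
        exact ⟨∅, by simp, fun S hS => hC S (by simpa using hS)⟩

/-- Remove a Set, if there is one, and collect its cards. -/
def greedyStep (s : List (Card n) × List (Card n)) : List (Card n) × List (Card n) :=
  (moves s.1).head?.elim s fun p => (remove s.1 p, p.1 :: p.2 :: -(p.1 + p.2) :: s.2)

theorem greedyStep_of_nil {s : List (Card n) × List (Card n)} (h : moves s.1 = []) :
    greedyStep s = s := by simp [greedyStep, h]

theorem greedyStep_of_ne_nil {s : List (Card n) × List (Card n)} (h : moves s.1 ≠ []) :
    ∃ p ∈ moves s.1, greedyStep s = (remove s.1 p, p.1 :: p.2 :: -(p.1 + p.2) :: s.2) := by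
  obtain ⟨p, l, h⟩ := List.exists_cons_of_ne_nil h
  exact ⟨p, by simp [h], by simp [greedyStep, h]⟩

/-- No Set avoids `P`, so each greedy removal takes a card of `P` from the table; what is left of
`P` still meets all remaining Sets and is strictly smaller. -/
theorem moves_greedyStep_iterate : ∀ (m : ℕ) (s : List (Card n) × List (Card n))
    (P : Finset (Card n)), P.card ≤ m → (∀ S ⊆ s.1.toFinset \ P, ¬ IsSet S) →
    moves (greedyStep^[m] s).1 = []
  | 0, s, P, hP, h => by
    obtain rfl : P = ∅ := Finset.card_eq_zero.1 (by omega)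
    rw [Function.iterate_zero, id, ← moverLosesWithin_zero_iff, MoverLosesWithin]
    simpa using h
  | m + 1, s, P, hP, h => by
    by_cases hs : moves s.1 = []
    · rwa [Function.iterate_fixed (greedyStep_of_nil hs)]
    obtain ⟨p, hp, e⟩ := greedyStep_of_ne_nil hs
    rw [Function.iterate_succ_apply, e]
    refine moves_greedyStep_iterate m _ (P \ {p.1, p.2, -(p.1 + p.2)}) ?_ fun S hS => h S ?_
    · have h₁ : ¬ Disjoint P {p.1, p.2, -(p.1 + p.2)} := fun hd => by
        obtain ⟨hp₁, hp₂⟩ := mem_moves.1 hp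
        refine h {p.1, p.2, -(p.1 + p.2)} ?_ (isSet_iff.2 ⟨_, _, hp₂, rfl⟩)
        rw [Finset.subset_sdiff]
        exact ⟨by simpa [Finset.insert_subset_iff] using hp₁, hd.symm⟩
      obtain ⟨c, hc, hc'⟩ := Finset.not_disjoint_iff.1 h₁
      have := Finset.card_lt_card (s := P \ {p.1, p.2, -(p.1 + p.2)}) (t := P)
        ((Finset.ssubset_iff_of_subset Finset.sdiff_subset).2
          ⟨c, hc, fun h => (Finset.mem_sdiff.1 h).2 hc'⟩)
      omega
    · refine hS.trans ?_
      rw [toFinset_remove]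
      intro c
      simp only [Finset.mem_sdiff]
      tauto

theorem greedyStep_iterate (C : List (Card n)) (m : ℕ) :
    List.Sublist (greedyStep^[m] (C, [])).1 C ∧ (greedyStep^[m] (C, [])).2.length ≤ 3 * m ∧
      (∀ c ∈ (greedyStep^[m] (C, [])).2, c ∈ C) ∧
      ∀ c ∈ C, c ∈ (greedyStep^[m] (C, [])).1 ∨ c ∈ (greedyStep^[m] (C, [])).2 := by
  induction m with
  | zero => simp
  | succ m ih =>
    rw [Function.iterate_succ_apply']
    obtain ⟨h₁, h₂, h₄, h₃⟩ := ih
    by_cases hs : moves (greedyStep^[m] (C, [])).1 = []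
    · rw [greedyStep_of_nil hs]
      exact ⟨h₁, by omega, h₄, h₃⟩
    obtain ⟨p, hp, e⟩ := greedyStep_of_ne_nil hs
    rw [e]
    obtain ⟨⟨hp₁, hp₂, hp₃⟩, -⟩ := mem_moves.1 hp
    refine ⟨List.filter_sublist.trans h₁, by simp only [List.length_cons]; omega, ?_,
      fun c hc => ?_⟩
    · simp only [List.mem_cons, forall_eq_or_imp]
      exact ⟨h₁.subset hp₁, h₁.subset hp₂, h₁.subset hp₃, h₄⟩
    · rcases h₃ c hc with h | h
      · by_cases hc' : c ∈ remove (greedyStep^[m] (C, [])).1 p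
        · exact .inl hc'
        · right
          simp only [remove, List.mem_filter, h, true_and] at hc'
          simp only [List.mem_cons]
          simp only [Bool.not_eq_true', Bool.or_eq_false_iff, decide_eq_false_iff_not] at hc'
          tauto
      · right
        simp [h]

/-- Remove Sets as long as possible, but at most `3 * R.length` times. -/
def greedy (C : List (Card n)) (R : List Symbol) : List (Card n) × List (Card n) :=
  (R ++ R ++ R).foldl (fun s _ => greedyStep s) (C, [])

theorem greedy_eq (C : List (Card n)) (R : List Symbol) :
    greedy C R = greedyStep^[3 * R.length] (C, []) := by
  rw [greedy, List.foldl_const]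
  congr 1
  simp; omega

/-- Add the multiples of a card to a list of cards. -/
def spanStep (L : List (Card n)) (h : Card n) : List (Card n) :=
  L ++ (L.map (fun v => v + h) ++ L.map fun v => v + h + h)

/-- The linear combinations of cards. -/
def spanList (z : Card n) (H : List (Card n)) : List (Card n) := H.foldl spanStep [z]

theorem length_spanList (z : Card n) (H : List (Card n)) :
    (spanList z H).length = 3 ^ H.length := by
  have : ∀ (H L : List (Card n)), (H.foldl spanStep L).length = L.length * 3 ^ H.length := by
    intro H
    induction H with
    | nil => simp
    | cons h H ih =>
      intro L
      rw [List.foldl_cons, ih, List.length_cons, pow_succ, spanStep]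
      simp only [List.length_append, List.length_map]
      ring
  rw [spanList, this]
  simp

/-- Provides the homomorphism to the quotient by `G`, whose kernel is listed by `spanList 0 H` and
contains all cards of `H`. -/
theorem exists_spanList_eq (H : List (Card n)) :
    ∃ G : AddSubgroup (Card n), (∀ c, c ∈ spanList 0 H ↔ c ∈ G) ∧ ∀ h ∈ H, h ∈ G := by
  have key : ∀ (H L : List (Card n)) (G : AddSubgroup (Card n)), (∀ c, c ∈ L ↔ c ∈ G) →
      ∃ G' : AddSubgroup (Card n), (∀ c, c ∈ H.foldl spanStep L ↔ c ∈ G') ∧ G ≤ G' ∧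
        ∀ h ∈ H, h ∈ G' := by
    intro H
    induction H with
    | nil => exact fun L G h => ⟨G, h, le_rfl, by simp⟩
    | cons h H ih =>
      intro L G hG
      obtain ⟨G', h₁, h₂, h₃⟩ := ih (spanStep L h) (G ⊔ AddSubgroup.zmultiples h) fun c => by
        rw [AddSubgroup.mem_sup]
        simp only [spanStep, List.mem_append, List.mem_map, AddSubgroup.mem_zmultiples_iff, hG]
        constructor
        · rintro (hc | ⟨v, hv, rfl⟩ | ⟨v, hv, rfl⟩)
          · exact ⟨c, hc, 0, ⟨0, by simp⟩, by simp⟩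
          · exact ⟨v, hv, h, ⟨1, by simp⟩, rfl⟩
          · exact ⟨v, hv, h + h, ⟨2, by rw [two_zsmul]⟩, by rw [add_assoc]⟩
        · rintro ⟨v, hv, _, ⟨k, rfl⟩, rfl⟩
          -- The group has exponent three, so only the multiples by 0, 1 and 2 occur; these are the
          -- three pieces of `spanStep`.
          have h3 : (3 : ℤ) • h = 0 := by
            rw [show (3 : ℤ) = 1 + 1 + 1 by rfl, add_zsmul, add_zsmul, one_zsmul,
              Card.add_add_self]
          have hk : k • h = (k % 3) • h := by
            conv_lhs => rw [← Int.mul_ediv_add_emod k 3, add_zsmul, mul_comm, mul_zsmul, h3,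
              zsmul_zero, zero_add]
          rw [hk]
          have : k % 3 = 0 ∨ k % 3 = 1 ∨ k % 3 = 2 := by omega
          rcases this with e | e | e <;> rw [e]
          · left; simpa using hv
          · right; left; exact ⟨v, hv, by simp⟩
          · right; right; exact ⟨v, hv, by rw [two_zsmul, add_assoc]⟩
      refine ⟨G', h₁, le_sup_left.trans h₂, ?_⟩
      simp only [List.mem_cons, forall_eq_or_imp]
      exact ⟨h₂ (AddSubgroup.mem_sup_right (AddSubgroup.mem_zmultiples h)), h₃⟩
  obtain ⟨G, h₁, -, h₂⟩ := key H [0] ⊥ (by simp)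
  exact ⟨G, h₁, h₂⟩

end SetGame

-- The kernel, the table of positions and the decision algorithm

namespace SetGame

variable {n : ℕ}

/-- The trace of the cards of `C` in the orbit of `x`, where `L` is a list of translations. -/
def orbitType (L C : List (Card n)) (x : Card n) : List (Bool × Bool) :=
  L.map fun v => (decide (x + v ∈ C), decide (-x + v ∈ C))

/-- Whether `x` and `y` are in the same orbit under the translations `L` and negation. -/
def inOrbit (L : List (Card n)) (x y : Card n) : Bool :=
  decide (y - x ∈ L) || decide (y + x ∈ L)

/-- The cards outside `L` whose orbits have the same trace as that of `x`. -/
def alike (L C : List (Card n)) (x : Card n) : List (Card n) :=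
  C.filter fun y => !decide (y ∈ L) && decide (orbitType L C y = orbitType L C x)

/-- Whether there are so many cards like `x` that its orbit is redundant. -/
def redundant (L T C : List (Card n)) (x : Card n) : Bool :=
  !decide (x ∈ L) && decide (T.length < (alike L C x).length)

/-- Remove a redundant orbit, if there is one. -/
def kernelStep (L T C : List (Card n)) : List (Card n) :=
  (C.filter (redundant L T C)).head?.elim C fun x => C.filter fun y => !inOrbit L x y

/-- Remove redundant orbits as long as possible. -/
def kernel (L T C : List (Card n)) : List (Card n) := C.foldl (fun D _ => kernelStep L T D) C

theorem kernel_eq (L T C : List (Card n)) : kernel L T C = (kernelStep L T)^[C.length] C :=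
  List.foldl_const _ _ _

theorem kernelStep_of_nil {L T C : List (Card n)} (h : C.filter (redundant L T C) = []) :
    kernelStep L T C = C := by simp [kernelStep, h]

theorem kernelStep_of_ne_nil {L T C : List (Card n)} (h : C.filter (redundant L T C) ≠ []) :
    ∃ x ∈ C, redundant L T C x = true ∧
      kernelStep L T C = C.filter fun y => !inOrbit L x y := by
  obtain ⟨p, l, h⟩ := List.exists_cons_of_ne_nil h
  have : p ∈ C.filter (redundant L T C) := by simp [h]
  rw [List.mem_filter] at this
  exact ⟨p, this.1, this.2, by simp [kernelStep, h]⟩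

theorem kernelStep_sublist (L T C : List (Card n)) : List.Sublist (kernelStep L T C) C := by
  by_cases h : C.filter (redundant L T C) = []
  · rw [kernelStep_of_nil h]
  · obtain ⟨x, -, -, e⟩ := kernelStep_of_ne_nil h
    rw [e]
    exact List.filter_sublist

theorem kernelStep_iterate_sublist (L T : List (Card n)) (m : ℕ) :
    ∀ C : List (Card n), List.Sublist ((kernelStep L T)^[m] C) C := by
  induction m with
  | zero => exact fun C => .refl _
  | succ m ih =>
    intro C
    rw [Function.iterate_succ_apply']
    exact (kernelStep_sublist L T _).trans (ih C)

/-- A step that finds a redundant orbit removes at least the card `x` itself, since zero belongs to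
`L`. So as many steps as there are cards suffice. -/
theorem filter_redundant_iterate {L T : List (Card n)} (h0 : (0 : Card n) ∈ L) (m : ℕ) :
    ∀ C : List (Card n), C.length ≤ m →
      ((kernelStep L T)^[m] C).filter (redundant L T ((kernelStep L T)^[m] C)) = [] := by
  induction m with
  | zero =>
    intro C hC
    obtain rfl := List.length_eq_zero_iff.1 (Nat.le_zero.1 hC)
    rfl
  | succ m ih =>
    intro C hC
    by_cases h : C.filter (redundant L T C) = []
    · rwa [Function.iterate_fixed (kernelStep_of_nil h)]
    · rw [Function.iterate_succ_apply]
      refine ih _ ?_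
      obtain ⟨x, hx, -, e⟩ := kernelStep_of_ne_nil h
      have : (kernelStep L T C).length < C.length := by
        rw [e]
        refine lt_of_le_of_ne (List.length_filter_le _ _) fun he => ?_
        have := List.length_filter_eq_length_iff.1 he x hx
        simp [inOrbit, h0] at this
      omega

/-- The cards outside `L` are sorted by their trace. There are at most `4 ^ L.length` traces, and
since nothing is redundant in the kernel, each belongs to at most `T.length` cards. -/
theorem length_kernel_le {L T C : List (Card n)} (h0 : (0 : Card n) ∈ L) (hC : C.Nodup) :
    (kernel L T C).length ≤ L.length + T.length * 4 ^ L.length := by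
  have hK : (kernel L T C).Nodup := by
    rw [kernel_eq]; exact hC.sublist (kernelStep_iterate_sublist _ _ _ _)
  have hred : (kernel L T C).filter (redundant L T (kernel L T C)) = [] := by
    rw [kernel_eq]; exact filter_redundant_iterate h0 _ _ le_rfl
  generalize kernel L T C = K at hK hred
  rw [List.filter_eq_nil_iff] at hred
  rw [← List.toFinset_card_of_nodup hK, ← Finset.card_filter_add_card_filter_not (· ∈ L)]
  refine Nat.add_le_add ?_ ?_
  · refine le_trans (Finset.card_le_card (t := L.toFinset) fun c hc => ?_) L.toFinset_card_le
    exact List.mem_toFinset.2 (Finset.mem_filter.1 hc).2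
  -- Traces are recoded as functions on the positions of `L`, so that the codomain is finite and can
  -- be counted.
  · let g : Card n → Fin L.length → Bool × Bool := fun x i =>
      (decide (x + L[i] ∈ K), decide (-x + L[i] ∈ K))
    have hg : ∀ x y, g x = g y → orbitType L K x = orbitType L K y := by
      intro x y h
      refine List.map_congr_left fun v hv => ?_
      obtain ⟨i, hi, rfl⟩ := List.getElem_of_mem hv
      exact congrFun h ⟨i, hi⟩
    refine (Finset.card_le_mul_card_image (f := g) _ T.length fun b hb => ?_).trans
      (Nat.mul_le_mul_left _ ((Finset.card_le_univ _).trans (by simp)))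
    obtain ⟨x, hx, rfl⟩ := Finset.mem_image.1 hb
    rw [Finset.mem_filter, List.mem_toFinset] at hx
    have h := hred x hx.1
    simp only [redundant, hx.2, decide_false, Bool.not_false, Bool.true_and,
      decide_eq_true_eq, not_lt] at h
    refine le_trans (le_trans (Finset.card_le_card (t := (alike L K x).toFinset) fun y hy => ?_)
      (List.toFinset_card_le _)) h
    simp only [Finset.mem_filter, List.mem_toFinset] at hy
    simp [alike, hy.1, hg _ _ hy.2]

/-- A long list that serves as the bound for the number of cards that are alike. -/
def threshold (R : List Symbol) (L : List (Card n)) : List (Card n) :=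
  (Symbol.tick :: R).flatMap fun _ => L ++ L

theorem length_threshold (R : List Symbol) (L : List (Card n)) :
    (threshold R L).length = (R.length + 1) * (2 * L.length) := by
  simp [threshold, List.length_flatMap]
  ring

section

variable {Q : Type} [AddCommGroup Q] {f : Card n →+ Q} {L C : List (Card n)}

theorem inOrbit_iff (hf : ∀ c, f c = 0 ↔ c ∈ L)
    {x y : Card n} : inOrbit L x y = true ↔ SameOrbit f x y := by
  simp only [inOrbit, SameOrbit, Bool.or_eq_true, decide_eq_true_eq, ← hf, map_sub, map_add,
    sub_eq_zero, add_eq_zero_iff_eq_neg]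

theorem similar_of_orbitType_eq (hf : ∀ c, f c = 0 ↔ c ∈ L)
    {x y : Card n} (h : orbitType L C y = orbitType L C x) :
    Similar f C.toFinset x y := by
  intro v hv
  have := List.map_inj_left.1 h v ((hf v).1 hv)
  simp only [Prod.mk.injEq, decide_eq_decide] at this
  simp only [List.mem_toFinset]
  exact ⟨this.1.symm, this.2.symm⟩

-- The orbit consists of two cosets of the kernel of `f`, and `L` lists this kernel.
open Classical in
theorem card_filter_sameOrbit_le (hf : ∀ c, f c = 0 ↔ c ∈ L) (A : Finset (Card n)) (x : Card n) :
    (A.filter (SameOrbit f x)).card ≤ 2 * L.length := by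
  refine le_trans (Finset.card_le_card
    (t := (L.map (fun v => v + x) ++ L.map fun v => v - x).toFinset) fun y hy => ?_)
    ((List.toFinset_card_le _).trans (by simp; omega))
  have h := (inOrbit_iff hf).2 (Finset.mem_filter.1 hy).2
  simp only [inOrbit, Bool.or_eq_true, decide_eq_true_eq] at h
  simp only [List.mem_toFinset, List.mem_append, List.mem_map]
  rcases h with h | h
  · exact .inl ⟨_, h, by abel⟩
  · exact .inr ⟨_, h, by abel⟩

-- Cards are chosen one after the other; each choice excludes only its own orbit, that is, at most
-- `2 * L.length` cards.
open Classical in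
theorem exists_transversal (hf : ∀ c, f c = 0 ↔ c ∈ L)
    (m : ℕ) : ∀ A : Finset (Card n), m * (2 * L.length) < A.card →
    ∃ X ⊆ A, X.card = m + 1 ∧ ∀ y ∈ X, ∀ z ∈ X, y ≠ z → ¬ SameOrbit f y z := by
  induction m with
  | zero =>
    intro A hA
    obtain ⟨a, ha⟩ := Finset.card_pos.1 (lt_of_le_of_lt (Nat.zero_le _) hA)
    exact ⟨{a}, by simpa using ha, by simp, by simp⟩
  | succ m ih =>
    intro A hA
    obtain ⟨a, ha⟩ := Finset.card_pos.1 (lt_of_le_of_lt (Nat.zero_le _) hA)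
    have h₁ := card_filter_sameOrbit_le hf A a
    have h₂ := Finset.card_filter_add_card_filter_not (s := A) (SameOrbit f a)
    obtain ⟨X, hXA, hX, hX'⟩ := ih (A.filter fun c => ¬ SameOrbit f a c) (by
      rw [Nat.succ_mul] at hA
      omega)
    have haX : ∀ z ∈ X, ¬ SameOrbit f a z := fun z hz => (Finset.mem_filter.1 (hXA hz)).2
    refine ⟨insert a X, ?_, ?_, ?_⟩
    · rw [Finset.insert_subset_iff]
      exact ⟨ha, hXA.trans (Finset.filter_subset _ _)⟩
    · rw [Finset.card_insert_of_notMem fun h => haX a h (.refl a), hX]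
    · intro y hy z hz hyz
      rcases Finset.mem_insert.1 hy with rfl | hy' <;>
        rcases Finset.mem_insert.1 hz with rfl | hz'
      · exact absurd rfl hyz
      · exact haX z hz'
      · exact fun h => haX y hy' h.symm
      · exact hX' y hy' z hz' hyz

/-- Explains the threshold `(R.length + 1) * (2 * L.length)`: one summand `2 * L.length` covers the
orbit of `x` itself, and the more than `R.length * (2 * L.length)` remaining cards alike meet at
least `R.length + 1` other orbits. -/
theorem copies_of_redundant (hf : ∀ c, f c = 0 ↔ c ∈ L)
    {R : List Symbol} (hC : C.Nodup) {x : Card n}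
    (hx : redundant L (threshold R L) C x = true) :
    f x ≠ 0 ∧ Copies f (R.length + 1) C.toFinset x := by
  classical
  simp only [redundant, Bool.and_eq_true, Bool.not_eq_true', decide_eq_false_iff_not,
    decide_eq_true_eq, length_threshold] at hx
  obtain ⟨hx, hT⟩ := hx
  refine ⟨fun h => hx ((hf x).1 h), ?_⟩
  have hnd : (alike L C x).Nodup := hC.sublist List.filter_sublist
  rw [← List.toFinset_card_of_nodup hnd] at hT
  have h₁ := card_filter_sameOrbit_le hf (alike L C x).toFinset x
  have h₂ := Finset.card_filter_add_card_filter_not (s := (alike L C x).toFinset) (SameOrbit f x)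
  obtain ⟨X, hXA, hX, hX'⟩ := exists_transversal hf R.length
    ((alike L C x).toFinset.filter fun c => ¬ SameOrbit f x c) (by
      rw [Nat.succ_mul] at hT
      omega)
  refine ⟨X, hX.ge, fun y hy => ?_, hX'⟩
  have := Finset.mem_filter.1 (hXA hy)
  simp only [alike, List.mem_toFinset, List.mem_filter, Bool.and_eq_true, Bool.not_eq_true',
    decide_eq_false_iff_not, decide_eq_true_eq] at this
  exact ⟨fun h => this.1.2.1 ((hf y).1 h), this.2, similar_of_orbitType_eq hf this.1.2.2⟩

theorem kernelStep_iterate_iff (hf : ∀ c, f c = 0 ↔ c ∈ L)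
    {R : List Symbol} (hC : C.Nodup) (hm : Meets f C.toFinset)
    (m : ℕ) : MoverWinsWithin R.length ((kernelStep L (threshold R L))^[m] C).toFinset ↔
      MoverWinsWithin R.length C.toFinset := by
  induction m generalizing C with
  | zero => rfl
  | succ m ih =>
    rw [Function.iterate_succ_apply]
    have hs := kernelStep_sublist L (threshold R L) C
    rw [ih (hC.sublist hs) (hm.mono fun c hc =>
      List.mem_toFinset.2 (hs.subset (List.mem_toFinset.1 hc)))]
    by_cases h : C.filter (redundant L (threshold R L) C) = []
    · rw [kernelStep_of_nil h]
    · obtain ⟨x, hx, hred, e⟩ := kernelStep_of_ne_nil h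
      obtain ⟨hx0, hcop⟩ := copies_of_redundant hf hC hred
      rw [(deleteOrbit_iff R.length C.toFinset x hx0 hm hcop).1, e]
      have : (C.filter fun y => !inOrbit L x y).toFinset = deleteOrbit f C.toFinset x := by
        ext c
        rw [mem_deleteOrbit, List.mem_toFinset, List.mem_toFinset, List.mem_filter,
          ← inOrbit_iff hf]
        simp
      rw [this]

end

/-- From the positions which are won, and lost, within some number of rounds, obtain those which
are won, and lost, within one more round, among the positions `S`. -/
def tableStep (S : List (List (Card n))) (t : List (List (Card n)) × List (List (Card n))) :
    List (List (Card n)) × List (List (Card n)) :=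
  (S.filter fun C => (moves C).any fun p => decide (remove C p ∈ t.2),
    S.filter fun C => !(moves C).any fun p => !decide (remove C p ∈ t.1))

/-- The positions among `S` which are won, and lost, within `R.length` rounds. -/
def table (S : List (List (Card n))) (R : List Symbol) :
    List (List (Card n)) × List (List (Card n)) :=
  R.foldl (fun t _ => tableStep S t) ([], S.filter fun C => (moves C).isEmpty)

/-- The recursion of the game never leaves `S` because `S` is closed under `remove`. For the
sublists of a list this holds literally, as `remove` is a filter and keeps the order. -/
theorem mem_table {S : List (List (Card n))} (hS : ∀ C ∈ S, ∀ p, remove C p ∈ S) (R : List Symbol)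
    (C : List (Card n)) :
    (C ∈ (table S R).1 ↔ C ∈ S ∧ MoverWinsWithin R.length C.toFinset) ∧
      (C ∈ (table S R).2 ↔ C ∈ S ∧ MoverLosesWithin R.length C.toFinset) := by
  rw [table, List.foldl_const]
  generalize R.length = k
  induction k generalizing C with
  | zero =>
    simp [moverLosesWithin_zero_iff, MoverWinsWithin]
  | succ k ih =>
    rw [Function.iterate_succ_apply', moverWinsWithin_succ_iff, moverLosesWithin_succ_iff]
    simp only [tableStep, List.mem_filter, List.any_eq_true, decide_eq_true_eq, ih,
      Bool.not_eq_true', List.any_eq_false, decide_eq_false_iff_not, not_not]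
    refine ⟨and_congr_right fun hC => exists_congr fun p => and_congr_right fun _ => ?_,
      and_congr_right fun hC => forall_congr' fun p => imp_congr_right fun _ => ?_⟩
    · exact and_iff_right (hS C hC p)
    · exact and_iff_right (hS C hC p)

/-- The decision algorithm: `R` represents the number of rounds and `z` is the zero card. -/
def solve (R : List Symbol) (z : Card n) (C : List (Card n)) : Bool :=
  (moves (greedy C R).1).isEmpty &&
    decide (kernel (spanList z (greedy C R).2) (threshold R (spanList z (greedy C R).2)) C ∈
      (table (kernel (spanList z (greedy C R).2) (threshold R (spanList z (greedy C R).2))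
        C).sublists' R).1)

theorem solve_iff (R : List Symbol) {C : List (Card n)} (hC : C.Nodup) :
    solve R 0 C = true ↔ MoverWinsWithin R.length C.toFinset := by
  have hs : ∀ K C' : List (Card n), C' ∈ K.sublists' → ∀ p, remove C' p ∈ K.sublists' := by
    intro K C' h p
    rw [List.mem_sublists'] at h ⊢
    exact List.filter_sublist.trans h
  rw [solve, Bool.and_eq_true, decide_eq_true_eq, (mem_table (hs _) R _).1, List.isEmpty_iff,
    and_iff_right (List.mem_sublists'.2 (.refl _))]
  obtain ⟨h₁, -, -, h₃⟩ := greedyStep_iterate C (3 * R.length)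
  rw [← greedy_eq] at h₁ h₃
  by_cases h : moves (greedy C R).1 = []
  · rw [and_iff_right h]
    obtain ⟨G, hG, hH⟩ := exists_spanList_eq (greedy C R).2
    have hf : ∀ c, QuotientAddGroup.mk' G c = 0 ↔ c ∈ spanList 0 (greedy C R).2 := fun c => by
      rw [hG, QuotientAddGroup.mk'_apply, QuotientAddGroup.eq_zero_iff]
    rw [kernel_eq]
    refine kernelStep_iterate_iff hf hC (fun S hSC hS => ?_) _
    -- A Set without a card in the span contains none of the cards removed greedily, so it would
    -- still be on the table after the greedy phase, where no Set is left.
    by_contra hcon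
    push Not at hcon
    rw [← moverLosesWithin_zero_iff, MoverLosesWithin] at h
    refine h S (fun s hs => ?_) hS
    have := h₃ s (List.mem_toFinset.1 (hSC hs))
    refine List.mem_toFinset.2 (this.resolve_right fun hsH => hcon s hs ?_)
    rw [hf, hG]
    exact hH s hsH
  -- A win would yield at most `3 * R.length` cards that meet all Sets, and then the greedy phase
  -- would have removed every Set.
  · refine iff_of_false (fun h' => h h'.1) fun hw => h ?_
    obtain ⟨P, hP, hPs⟩ := exists_hitting _ _ (.inl hw)
    rw [greedy_eq]
    exact moves_greedyStep_iterate _ _ P hP hPs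

end SetGame

-- Feasibility of the decision algorithm

namespace SetGame

open Encodes (enc)

instance : Encodes (Fin 3) where
  enc v := match v with
    | 0 => .nil
    | 1 => .cons .nil .nil
    | 2 => .cons .nil (.cons .nil .nil)
  inj v w h := by fin_cases v <;> fin_cases w <;> simp at h ⊢

theorem size_enc_fin (v : Fin 3) : (enc v).size ≤ 5 := by
  fin_cases v <;> simp [enc]

instance : Encodes Symbol where
  enc s := match s with
    | .value v => .cons .nil (enc v)
    | .tick => .nil
    | .mark => .cons (.cons .nil .nil) .nil
  inj s t h := by
    cases s <;> cases t <;> simp at h ⊢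
    exact Encodes.inj _ _ h

theorem size_enc_symbol (s : Symbol) : (enc s).size ≤ 7 := by
  cases s with
  | value v => have := size_enc_fin v; simp [enc] at this ⊢; omega
  | tick => simp [enc]
  | mark => simp [enc]

instance {n : ℕ} : Encodes (Card n) where
  enc c := enc (List.ofFn c)
  inj _ _ h := List.ofFn_injective (Encodes.inj _ _ h)

theorem enc_card {n : ℕ} (c : Card n) : enc c = enc (List.ofFn c) := rfl

theorem size_enc_card {n : ℕ} (c : Card n) : (enc c).size ≤ n * 6 + 1 := by
  rw [enc_card]
  refine (size_le_of_forall (n := 5) fun v _ => size_enc_fin v).trans ?_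
  simp

theorem size_enc_list_card {n : ℕ} (L : List (Card n)) :
    (enc L).size ≤ L.length * (n * 6 + 2) + 1 :=
  size_le_of_forall fun c _ => size_enc_card c

namespace Feasible

variable {α : Type} {B : α → ℕ} {e : α → Datum}

theorem of_isEmpty [IsEmpty α] {F : α → Datum} : Feasible B e F :=
  ⟨⟨0, isEmptyElim⟩, ⟨0, isEmptyElim⟩, skip, fun _ => 0, .const 0, isEmptyElim⟩

/-- Functions on finite types are feasible. -/
theorem finite {β γ : Type} [Encodes β] [Encodes γ] [Fintype β] {x : α → β}
    (g : β → γ) (hx : Feasible B e fun a => enc (x a)) : Feasible B e fun a => enc (g (x a)) := by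
  classical
  have key : ∀ (l : List β) {α : Type} {B : α → ℕ} {e : α → Datum} {x : α → β}
      (_ : Feasible B e fun a => enc (x a)) (_ : ∀ a, x a ∈ l),
      Feasible B e fun a => enc (g (x a)) := by
    intro l
    induction l with
    | nil =>
      intro α B e x _ h
      have : IsEmpty α := ⟨fun a => by simpa using h a⟩
      exact of_isEmpty
    | cons v l ih =>
      intro α B e x hx h
      refine cases (fun a => decide (x a = v))
        (hx.eq (y := fun _ => v) (const hx.1 (enc v))) ?_ ?_
      · convert const (B := fun a : {a // decide (x a = v) = true} => B a.1)
          (hx.1.reindex fun a : {a // decide (x a = v) = true} => a.1) (enc (g v)) using 2 with a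
        rw [of_decide_eq_true a.2]
      · refine ih (hx.reindex _) fun a => (List.mem_cons.1 (h a.1)).resolve_left ?_
        exact of_decide_eq_false a.2
  exact key Finset.univ.toList hx fun a => by simp

/-- The number of attributes varies with the index, so cards are handled as lists of values. The
accumulator consists of the unread values of `y` and the results so far in reverse order. -/
theorem cardMap₂ {n : α → ℕ} {x y : ∀ a, Card (n a)} (op : Fin 3 → Fin 3 → Fin 3)
    (hx : Feasible B e fun a => enc (x a)) (hy : Feasible B e fun a => enc (y a)) :
    Feasible B e fun a => enc (fun i => op (x a i) (y a i) : Card (n a)) := by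
  have h : ∀ (xs ys out : List (Fin 3)), xs.foldl (fun (c : List (Fin 3) × List (Fin 3)) x =>
      (c.1.tail, c.1.head?.elim c.2 fun y => op x y :: c.2)) (ys, out) =
      (ys.drop xs.length, (List.zipWith op xs ys).reverse ++ out) := by
    intro xs
    induction xs with
    | nil => simp
    | cons x xs ih =>
      intro ys out
      rw [List.foldl_cons, ih]
      cases ys <;> simp
  have hsize : ∀ (xs ys : List (Fin 3)),
      (enc (ys.drop xs.length, (List.zipWith op xs ys).reverse ++ [])).size ≤
        (enc ys).size + (enc ys).size * 6 + 2 := by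
    intro xs ys
    rw [enc_prod, Datum.size_cons, List.append_nil, size_enc_reverse]
    have h₁ := size_le_of_sublist (List.drop_sublist xs.length ys)
    have h₂ := size_le_of_forall (l := List.zipWith op xs ys) (n := 5) fun v _ => size_enc_fin v
    have h₃ := length_le_size ys
    rw [List.length_zipWith] at h₂
    have h₄ : min xs.length ys.length * (5 + 1) ≤ (enc ys).size * 6 :=
      Nat.mul_le_mul_right _ ((min_le_right _ _).trans h₃)
    dsimp only
    omega
  have hy' : Feasible B e fun a => enc (List.ofFn (y a)) := hy
  have hx' : Feasible B e fun a => enc (List.ofFn (x a)) := hx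
  have := (foldl (z := fun a => (List.ofFn (y a), ([] : List (Fin 3))))
    (fun a (c : List (Fin 3) × List (Fin 3)) x =>
      (c.1.tail, c.1.head?.elim c.2 fun y => op x y :: c.2)) hx' (hy'.prodMk (nil hx.1))
    ⟨_, (hy'.size_le.add (hy'.size_le.mul (.const 6))).add (.const 2), fun a pre post _ => by
      rw [h]; exact hsize _ _⟩
    fun env hx hc up => hc.prodFst.tail.prodMk (headElim hc.prodFst hc.prodSnd fun hy up' =>
      ((up' hx).prodMk hy).finite (fun p => op p.1 p.2) |>.cons (up' hc.prodSnd))).prodSnd.reverse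
  convert this using 3 with a
  rw [h, enc_card]
  congr 1
  rw [List.append_nil, List.reverse_reverse]
  refine List.ext_getElem (by simp) fun i h₁ h₂ => by simp

end Feasible

section Algorithm

variable {α : Type} {B : α → ℕ} {e : α → Datum} {n : α → ℕ} {x y z : ∀ a, Card (n a)}
  {C L T : ∀ a, List (Card (n a))} {R : α → List Symbol}

theorem feasible_add (hx : Feasible B e fun a => enc (x a)) (hy : Feasible B e fun a => enc (y a)) :
    Feasible B e fun a => enc (x a + y a) := hx.cardMap₂ (fun v w => v + w) hy

theorem feasible_sub (hx : Feasible B e fun a => enc (x a)) (hy : Feasible B e fun a => enc (y a)) :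
    Feasible B e fun a => enc (x a - y a) := hx.cardMap₂ (fun v w => v - w) hy

theorem feasible_neg_add_right (hx : Feasible B e fun a => enc (x a))
    (hy : Feasible B e fun a => enc (y a)) : Feasible B e fun a => enc (-x a + y a) :=
  hx.cardMap₂ (fun v w => -v + w) hy

theorem feasible_third (hx : Feasible B e fun a => enc (x a))
    (hy : Feasible B e fun a => enc (y a)) : Feasible B e fun a => enc (-(x a + y a)) :=
  hx.cardMap₂ (fun v w => -(v + w)) hy

theorem feasible_moves (hC : Feasible B e fun a => enc (C a)) :
    Feasible B e fun a => enc (moves (C a)) := by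
  unfold moves
  exact hC.flatMap fun env hx up => .map (.filter (up hC) fun env hy up' =>
    .and (.not (.eq (up' hx) hy)) (.mem (feasible_third (up' hx) hy) (up' (up hC))))
    fun env hy up' => .prodMk (up' hx) hy

theorem feasible_remove {p : ∀ a, Card (n a) × Card (n a)} (hC : Feasible B e fun a => enc (C a))
    (hp : Feasible B e fun a => enc (p a)) : Feasible B e fun a => enc (remove (C a) (p a)) := by
  unfold remove
  exact hC.filter fun env hx up => .not (.or (.or (.eq hx (up hp.prodFst))
    (.eq hx (up hp.prodSnd))) (.eq hx (up (feasible_third hp.prodFst hp.prodSnd))))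

theorem feasible_greedyStep {s : ∀ a, List (Card (n a)) × List (Card (n a))}
    (hs : Feasible B e fun a => enc (s a)) : Feasible B e fun a => enc (greedyStep (s a)) := by
  unfold greedyStep
  exact .headElim (feasible_moves hs.prodFst) hs fun hp up =>
    .prodMk (feasible_remove (up hs.prodFst) hp) (.cons hp.prodFst (.cons hp.prodSnd
      (.cons (feasible_third hp.prodFst hp.prodSnd) (up hs.prodSnd))))

theorem feasible_greedy (hC : Feasible B e fun a => enc (C a))
    (hR : Feasible B e fun a => enc (R a)) :
    Feasible B e fun a => enc (greedy (C a) (R a)) := by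
  unfold greedy
  have hR' := (hR.append hR).append hR
  refine .foldl _ hR' (hC.prodMk (.nil hC.1)) ⟨_, (hC.size_le.add (((PowerBounded.const 3).mul
    hR'.size_le).mul hC.size_le.succ)).add (.const 2), fun a pre post h => ?_⟩
    fun env hx hc up => feasible_greedyStep hc
  rw [List.foldl_const, enc_prod, Datum.size_cons]
  obtain ⟨h₁, h₂, h₃, -⟩ := greedyStep_iterate (C a) pre.length
  have h₄ := size_le_of_sublist h₁
  have h₅ := size_le_of_forall fun c hc => size_le_of_mem (h₃ c hc)
  have h₆ : pre.length ≤ (enc (R a ++ R a ++ R a)).size :=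
    le_trans (by rw [h]; simp) (length_le_size _)
  have h₇ := Nat.mul_le_mul_right ((enc (C a)).size + 1)
    (h₂.trans (Nat.mul_le_mul_left 3 h₆))
  omega

theorem feasible_spanList (hn : PowerBounded B n) (hz : Feasible B e fun a => enc (z a))
    (hC : Feasible B e fun a => enc (C a)) (h3 : PowerBounded B fun a => 3 ^ (C a).length) :
    Feasible B e fun a => enc (spanList (z a) (C a)) := by
  unfold spanList
  refine .foldl _ hC (hz.cons (.nil hz.1)) ⟨_, (h3.mul ((hn.mul (.const 6)).add (.const 2))).succ,
    fun a pre post h => ?_⟩ fun env hx hc up => ?_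
  · refine (size_enc_list_card _).trans ?_
    rw [← spanList, length_spanList]
    refine Nat.add_le_add_right (Nat.mul_le_mul_right _ (Nat.pow_le_pow_right (by omega) ?_)) 1
    rw [h]
    simp
  · unfold spanStep
    exact hc.append (.append (hc.map fun env hv up' => feasible_add hv (up' hx))
      (hc.map fun env hv up' => feasible_add (feasible_add hv (up' hx)) (up' hx)))

theorem feasible_orbitType (hL : Feasible B e fun a => enc (L a))
    (hC : Feasible B e fun a => enc (C a)) (hx : Feasible B e fun a => enc (x a)) :
    Feasible B e fun a => enc (orbitType (L a) (C a) (x a)) := by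
  unfold orbitType
  exact hL.map fun env hv up => .prodMk (.mem (feasible_add (up hx) hv) (up hC))
    (.mem (feasible_neg_add_right (up hx) hv) (up hC))

theorem feasible_inOrbit (hL : Feasible B e fun a => enc (L a))
    (hx : Feasible B e fun a => enc (x a)) (hy : Feasible B e fun a => enc (y a)) :
    Feasible B e fun a => enc (inOrbit (L a) (x a) (y a)) :=
  .or (.mem (feasible_sub hy hx) hL) (.mem (feasible_add hy hx) hL)

theorem feasible_redundant (hL : Feasible B e fun a => enc (L a))
    (hT : Feasible B e fun a => enc (T a)) (hC : Feasible B e fun a => enc (C a))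
    (hx : Feasible B e fun a => enc (x a)) :
    Feasible B e fun a => enc (redundant (L a) (T a) (C a) (x a)) := by
  unfold redundant alike
  exact .and (.not (.mem hx hL)) (.length_lt (hC.filter fun env hy up =>
    .and (.not (.mem hy (up hL))) (.eq (feasible_orbitType (up hL) (up hC) hy)
      (up (feasible_orbitType hL hC hx)))) hT)

theorem feasible_kernel (hL : Feasible B e fun a => enc (L a))
    (hT : Feasible B e fun a => enc (T a)) (hC : Feasible B e fun a => enc (C a)) :
    Feasible B e fun a => enc (kernel (L a) (T a) (C a)) := by
  unfold kernel
  refine .foldl _ hC hC ⟨_, hC.size_le, fun a pre post h => ?_⟩ fun env hx hc up => ?_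
  · rw [List.foldl_const]
    exact size_le_of_sublist (kernelStep_iterate_sublist _ _ _ _)
  · unfold kernelStep
    exact .headElim (hc.filter fun env hx up' =>
      feasible_redundant (up' (up hL)) (up' (up hT)) (up' hc) hx) hc fun hx up' =>
      .filter (up' hc) fun env hy up'' => .not (feasible_inOrbit (up'' (up' (up hL))) (up'' hx) hy)

theorem feasible_threshold (hR : Feasible B e fun a => enc (R a))
    (hL : Feasible B e fun a => enc (L a)) :
    Feasible B e fun a => enc (threshold (R a) (L a)) := by
  unfold threshold
  exact .flatMap (.cons (x := fun _ => Symbol.tick) (.const hR.1 (enc Symbol.tick)) hR)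
    fun env hx up => .append (up hL) (up hL)

/-- The recursion builds the sublists from the end of the list, whereas feasible folds run from the
front; hence the reversal. -/
theorem sublists'_eq_foldl {β : Type} (l : List β) :
    l.sublists' = l.reverse.foldl (fun S x => S ++ S.map fun s => x :: s) [[]] := by
  rw [List.foldl_reverse]
  induction l with
  | nil => rfl
  | cons x l ih => rw [List.sublists'_cons, List.foldr_cons, ih]

theorem feasible_sublists' (hC : Feasible B e fun a => enc (C a))
    (h2 : PowerBounded B fun a => 2 ^ (C a).length) :
    Feasible B e fun a => enc (C a).sublists' := by
  simp only [sublists'_eq_foldl]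
  refine .foldl _ hC.reverse (.cons (.nil hC.1) (.nil hC.1))
    ⟨_, (h2.mul hC.size_le.succ).succ, fun a pre post h => ?_⟩
    fun env hx hc up => hc.append (hc.map fun env hs up' => .cons (up' hx) hs)
  rw [← List.reverse_reverse pre, ← sublists'_eq_foldl]
  refine (size_le_of_forall (n := (enc (C a)).size) fun s hs => ?_).trans ?_
  · refine (size_le_of_sublist (List.mem_sublists'.1 hs)).trans ?_
    rw [size_enc_reverse, ← size_enc_reverse (C a)]
    exact size_le_of_sublist (by rw [h]; exact List.sublist_append_left _ _)
  · rw [List.length_sublists']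
    refine Nat.add_le_add_right (Nat.mul_le_mul_right _ (Nat.pow_le_pow_right (by omega) ?_)) 1
    rw [List.length_reverse, ← List.length_reverse (as := C a), h]
    simp

theorem feasible_table {S : ∀ a, List (List (Card (n a)))} (hS : Feasible B e fun a => enc (S a))
    (hR : Feasible B e fun a => enc (R a)) :
    Feasible B e fun a => enc (table (S a) (R a)) := by
  unfold table
  refine .foldl _ hR (.prodMk (.nil hS.1) (hS.filter fun env hx up => (feasible_moves hx).isEmpty))
    ⟨_, (hS.size_le.add hS.size_le).succ, fun a pre post h => ?_⟩ fun env hx hc up => ?_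
  · have key : ∀ m, List.Sublist ((tableStep (S a))^[m]
        ([], (S a).filter fun C => (moves C).isEmpty)).1 (S a) ∧ List.Sublist ((tableStep (S a))^[m]
        ([], (S a).filter fun C => (moves C).isEmpty)).2 (S a) := by
      rintro (_ | m)
      · exact ⟨List.nil_sublist _, List.filter_sublist⟩
      · rw [Function.iterate_succ_apply']
        exact ⟨List.filter_sublist, List.filter_sublist⟩
    rw [List.foldl_const, enc_prod, Datum.size_cons]
    have h₁ := size_le_of_sublist (key pre.length).1
    have h₂ := size_le_of_sublist (key pre.length).2
    omega
  · unfold tableStep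
    exact .prodMk
      (.filter (up hS) fun env hx up' => .any (feasible_moves hx) fun env hp up'' =>
        .mem (feasible_remove (up'' hx) hp) (up'' (up' hc.prodSnd)))
      (.filter (up hS) fun env hx up' => .not (.any (feasible_moves hx) fun env hp up'' =>
        .not (.mem (feasible_remove (up'' hx) hp) (up'' (up' hc.prodFst)))))

/-- A bound for the number of cards in the kernel. -/
def kernelBound (r : ℕ) : ℕ := 3 ^ (9 * r) + (r + 1) * (2 * 3 ^ (9 * r)) * 4 ^ 3 ^ (9 * r)

/-- Only the span and the list of all sublists of the kernel can be exponentially large. Both are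
controlled by `2 ^ kernelBound r`: the span has at most `3 ^ (9 * r)` entries, and the kernel at
most `kernelBound r` cards by `length_kernel_le`. -/
theorem feasible_solve (hn : PowerBounded B n) (hR : Feasible B e fun a => enc (R a))
    (hz : Feasible B e fun a => enc (0 : Card (n a))) (hC : Feasible B e fun a => enc (C a))
    (hnodup : ∀ a, (C a).Nodup) (hB : PowerBounded B fun a => 2 ^ kernelBound (R a).length) :
    Feasible B e fun a => enc (solve (R a) 0 (C a)) := by
  have hg := feasible_greedy hC hR
  have hH : ∀ a, (greedy (C a) (R a)).2.length ≤ 9 * (R a).length := fun a => by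
    rw [greedy_eq]
    have := (greedyStep_iterate (C a) (3 * (R a).length)).2.1
    omega
  have h3 : ∀ a, 3 ^ (greedy (C a) (R a)).2.length ≤ 3 ^ (9 * (R a).length) := fun a =>
    Nat.pow_le_pow_right (by omega) (hH a)
  have hL := feasible_spanList hn hz hg.prodSnd (hB.mono fun a => (h3 a).trans
    ((Nat.le_add_right _ _).trans Nat.lt_two_pow_self.le))
  have hK := feasible_kernel hL (feasible_threshold hR hL) hC
  have h2 := feasible_sublists' hK (hB.mono fun a => Nat.pow_le_pow_right (by omega) <|
    (length_kernel_le (by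
      obtain ⟨G, hG, -⟩ := exists_spanList_eq (greedy (C a) (R a)).2
      exact (hG 0).2 G.zero_mem) (hnodup a)).trans (by
      rw [length_threshold, length_spanList]
      have := h3 a
      unfold kernelBound
      gcongr
      omega))
  unfold solve
  exact .and (feasible_moves hg.prodFst).isEmpty (.mem hK (feasible_table h2 hR).prodFst)

end Algorithm

end SetGame

-- Parsing the input, the complete program and its running time

namespace SetGame

open Encodes (enc)
open Prog

/-- The leading ticks of a string. -/
def ticks (s : List Symbol) : List Symbol := s.takeWhile fun c => decide (c = .tick)

/-- The part of a string after the leading ticks and the symbol that follows them. -/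
def afterTicks (s : List Symbol) : List Symbol := (s.drop (ticks s).length).tail

theorem ticks_replicate (r : ℕ) (s : List Symbol) :
    ticks (List.replicate r .tick ++ .mark :: s) = List.replicate r .tick := by
  unfold ticks
  rw [List.takeWhile_append_of_pos (by simp +contextual), List.takeWhile_cons_of_neg (by simp),
    List.append_nil]

theorem afterTicks_replicate (r : ℕ) (s : List Symbol) :
    afterTicks (List.replicate r .tick ++ .mark :: s) = s := by
  unfold afterTicks
  rw [ticks_replicate, List.drop_left]
  rfl

/-- The value denoted by a symbol. -/
def Symbol.toValue : Symbol → Fin 3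
  | .value v => v
  | _ => 0

/-- Put a symbol in front of a list of cards. -/
def readStep (st : List (List (Fin 3))) (c : Symbol) : List (List (Fin 3)) :=
  if decide (c = .mark) then [] :: st
  else st.head?.elim [] fun h => (c.toValue :: h) :: st.tail

/-- The list of the cards written in a string. -/
def readCards (s : List Symbol) : List (List (Fin 3)) := s.reverse.foldl readStep []

/-- The string is read from its end, so the mark that terminates a card is met first and opens a new
entry, which is then filled from the back. -/
theorem readCards_flatMap {n : ℕ} (C : List (Card n)) :
    readCards (C.flatMap fun c => (List.ofFn c).map Symbol.value ++ [Symbol.mark]) =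
      C.map List.ofFn := by
  have h : ∀ (l k : List (Fin 3)) (st : List (List (Fin 3))),
      (l.map Symbol.value).foldr (fun c st => readStep st c) (k :: st) = (l ++ k) :: st := by
    intro l k st
    induction l with
    | nil => rfl
    | cons v l ih => rw [List.map_cons, List.foldr_cons, ih]; simp [readStep, Symbol.toValue]
  unfold readCards
  rw [List.foldl_reverse]
  induction C with
  | nil => rfl
  | cons c C ih =>
    rw [List.flatMap_cons, List.foldr_append, ih, List.foldr_append, List.foldr_cons,
      List.foldr_nil, List.map_cons]
    exact (h _ _ _).trans (by simp)

theorem size_readStep_le (st : List (List (Fin 3))) (c : Symbol) :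
    (enc (readStep st c)).size ≤ (enc st).size + 6 := by
  unfold readStep
  split
  · rw [enc_cons, Datum.size_cons, enc_nil, Datum.size_nil]; omega
  · cases st with
    | nil => simp
    | cons h st =>
      have := size_enc_fin c.toValue
      simp only [List.head?_cons, Option.elim_some, List.tail_cons, enc_cons, Datum.size_cons]
      omega

/-- The parser yields lists of values whose type does not mention the number of attributes; as trees
they coincide with lists of cards. -/
theorem enc_list_card {n : ℕ} (C : List (Card n)) : enc C = enc (C.map List.ofFn) := by
  induction C with
  | nil => rfl
  | cons c C ih => rw [List.map_cons, enc_cons, enc_cons, ih, enc_card]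

section Parser

variable {α : Type} {B : α → ℕ} {e : α → Datum} {s : α → List Symbol}

theorem feasible_symbol (he : PowerBounded B fun a => (e a).size) (c : Symbol) :
    Feasible B e fun _ => enc c := .const he _

theorem takeWhile_eq_foldl {β : Type} (p : β → Bool) (l : List β) :
    l.takeWhile p = l.reverse.foldl (fun c x => if p x then x :: c else []) [] := by
  rw [List.foldl_reverse]
  induction l with
  | nil => rfl
  | cons x l ih => rw [List.takeWhile_cons, List.foldr_cons, ih]

theorem feasible_ticks (hs : Feasible B e fun a => enc (s a)) :
    Feasible B e fun a => enc (ticks (s a)) := by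
  unfold ticks
  simp only [takeWhile_eq_foldl]
  refine .foldl _ hs.reverse (.nil hs.1) ⟨_, hs.size_le, fun a pre post h => ?_⟩
    fun env hx hc up => .cond (.eq hx (feasible_symbol hx.1 .tick)) (hx.cons hc) (.nil hx.1)
  rw [← List.reverse_reverse pre, ← takeWhile_eq_foldl]
  refine (size_le_of_sublist (List.takeWhile_sublist _)).trans ?_
  rw [size_enc_reverse, ← size_enc_reverse (s a)]
  exact size_le_of_sublist (by rw [h]; exact List.sublist_append_left _ _)

theorem feasible_afterTicks (hs : Feasible B e fun a => enc (s a)) :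
    Feasible B e fun a => enc (afterTicks (s a)) := (hs.dropLength (feasible_ticks hs)).tail

theorem feasible_readCards (hs : Feasible B e fun a => enc (s a)) :
    Feasible B e fun a => enc (readCards (s a)) := by
  unfold readCards
  refine .foldl _ hs.reverse (.nil hs.1) ⟨_, (hs.size_le.mul (.const 6)).succ,
    fun a pre post h => ?_⟩ fun env hx hc up => ?_
  · have key : ∀ (l : List Symbol) (st : List (List (Fin 3))),
        (enc (l.foldl readStep st)).size ≤ l.length * 6 + (enc st).size := by
      intro l
      induction l with
      | nil => simp
      | cons c l ih =>
        intro st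
        have h₁ := ih (readStep st c)
        have h₂ := size_readStep_le st c
        rw [List.foldl_cons, List.length_cons]
        omega
    refine (key pre []).trans ?_
    rw [enc_nil, Datum.size_nil]
    have : pre.length ≤ (enc (s a)).size := by
      refine le_trans ?_ (length_le_size _)
      rw [← List.length_reverse (as := s a), h]
      simp
    omega
  · unfold readStep
    exact .cond (.eq hx (feasible_symbol hx.1 .mark)) (.cons (.nil hx.1) hc)
      (.headElim hc (.nil hx.1) fun hh up' =>
        .cons (.cons ((up' hx).finite Symbol.toValue) hh) (up' hc).tail)

end Parser

/-- The bound in powers of which the running time is measured. -/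
def bound (I : Instance) : ℕ := (I.encode.length + 2) * (2 ^ kernelBound I.rounds + 2)

/-- The answer computed by the machine. -/
def Instance.answer (I : Instance) : Bool :=
  solve (List.replicate I.rounds Symbol.tick) 0 I.cards

theorem Instance.answer_iff (I : Instance) : I.answer = true ↔ I.FirstPlayerWins := by
  rw [Instance.answer, solve_iff _ I.nodup, List.length_replicate, Instance.FirstPlayerWins]

theorem feasible_answer : Feasible bound (fun I => enc I.encode) fun I => enc I.answer := by
  have hlen : ∀ I : Instance, I.encode.length ≤ bound I := fun I =>
    (Nat.le_add_right _ 2).trans (Nat.le_mul_of_pos_right _ (Nat.succ_pos _))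
  have hs : Feasible bound (fun I => enc I.encode) fun I => enc I.encode :=
    .refl (((PowerBounded.self.mul (.const 8)).succ).mono fun I =>
      (size_le_of_forall fun c _ => size_enc_symbol c).trans
        (Nat.add_le_add_right (Nat.mul_le_mul_right _ (hlen I)) 1))
  have hR := feasible_ticks hs
  have hs₁ := feasible_afterTicks hs
  have hN := feasible_ticks hs₁
  have hC := feasible_readCards (feasible_afterTicks hs₁)
  -- The zero card is obtained by replacing each tick of the unary number of attributes by the value
  -- 0.
  have hz := hN.map (g := fun _ _ => (0 : Fin 3)) fun env hx up => .const hx.1 (enc (0 : Fin 3))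
  unfold Instance.encode at hR hN hC hz
  simp only [ticks_replicate, afterTicks_replicate, readCards_flatMap, ← enc_list_card,
    List.map_replicate] at hR hN hC hz
  refine feasible_solve (PowerBounded.self.mono fun I => le_trans ?_ (hlen I)) hR ?_ hC
    (fun I => I.nodup) (PowerBounded.self.mono fun I => ?_)
  · simp [Instance.encode]
    omega
  · have h0 : ∀ I : Instance, enc (0 : Card I.attributes) =
        enc (List.replicate I.attributes (0 : Fin 3)) := fun I => by
      rw [enc_card]
      congr 1
      exact List.ofFn_const _ _
    simp only [h0]
    exact hz
  · rw [List.length_replicate]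
    exact (Nat.le_add_right _ 2).trans (Nat.le_mul_of_pos_left _ (Nat.succ_pos _))

/-- Write the tree of the symbol in the register, and a cons symbol, to the main stack. -/
def loadSymbol : StackProg :=
  .seq (.ite (fun v => v.1 = some .tick) (putDatum (enc Symbol.tick))
    (.ite (fun v => v.1 = some .mark) (putDatum (enc Symbol.mark))
      (.ite (fun v => v.1 = some (.value 0)) (putDatum (enc (Symbol.value 0)))
        (.ite (fun v => v.1 = some (.value 1)) (putDatum (enc (Symbol.value 1)))
          (putDatum (enc (Symbol.value 2))))))) (put .main .mark)

theorem runs_loadSymbol (c : Symbol) (w : Bool) (l d : List Symbol) :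
    Runs loadSymbol (some c, w) (conf [] (enc d).code l [] [] [])
      (some c, w) (conf [] (enc (c :: d)).code l [] [] []) 12 := by
  have key : ∀ (c : Symbol) (p : StackProg), (∀ m : List Symbol, Runs p (some c, w)
      (conf [] m l [] [] []) (some c, w) (conf [] ((enc c).code ++ m) l [] [] []) 11) →
      Runs (.seq p (put .main .mark)) (some c, w) (conf [] (enc d).code l [] [] [])
        (some c, w) (conf [] (enc (c :: d)).code l [] [] []) 12 := fun c p h =>
    .seq (h _) runs_put_main
  refine key c _ fun m => ?_
  cases c with
  | tick => exact .mono (.ite_true rfl (runs_putDatum _)) (by simp [enc])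
  | mark => exact .mono (.ite_false rfl (.ite_true rfl (runs_putDatum _))) (by simp [enc])
  | value v =>
    fin_cases v
    · exact .mono (.ite_false rfl (.ite_false rfl (.ite_true rfl (runs_putDatum _))))
        (by simp [enc])
    · exact .mono (.ite_false rfl (.ite_false rfl (.ite_false rfl (.ite_true rfl
        (runs_putDatum _))))) (by simp [enc])
    · exact .mono (.ite_false rfl (.ite_false rfl (.ite_false rfl (.ite_false rfl
        (runs_putDatum _))))) (by simp [enc])

/-- Transform the input string into a tree on the main stack. -/
def load : StackProg :=
  .seq (flush .input (write .left)) (.seq (put .main .tick) (flush .left loadSymbol))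

/-- The string is first reversed onto the left stack, so that the tree of the list is built from its
last entry, starting with the tick for the empty list. -/
theorem runs_load (s : List Symbol) (v : Register) :
    Runs load v (conf s [] [] [] [] []) (none, v.2) (conf [] ((enc s).code ++ []) [] [] [] [])
      (17 * s.length + 5) := by
  have h := runs_flush (fun l d => conf [] (enc d).code l [] [] []) (fun _ _ _ => runs_read_left)
    (fun c w l d => runs_loadSymbol c w l d) (s.reverse ++ []) [] (none, v.2)
  have h' := Runs.seq (runs_flush_input_left (v := v) (i := s) (m := []) (a := []) (b := [])
    (c := []) (o := [])) (.seq (runs_put_main (s := .tick)) h)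
  simp only [List.append_nil, List.reverse_reverse, List.length_reverse] at h' ⊢
  exact h'.mono (by omega)

/-- Move a truth value from the main stack to the output. -/
def unload : StackProg :=
  .seq (read .main) (.ite (fun v => v.1 = some .mark)
    (.seq (.push none fun _ => true) (.seq (read .main) (.seq (read .main)
      (.load fun _ => (none, false)))))
    (.seq (.push none fun _ => false) (.load fun _ => (none, false))))

theorem runs_unload (b : Bool) (v : Register) :
    Runs unload v (conf [] ((enc b).code ++ []) [] [] [] []) (none, false)
      (conf [] [] [] [] [] [b]) 6 := by
  have h : ∀ (v : Register) (m : List Symbol), Runs (.push none fun _ => b) v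
      (conf [] m [] [] [] []) v (conf [] m [] [] [] [b]) 1 := by
    intro v m
    have := Runs.push (none : Option Stack) (fun _ : Register => b) v (conf [] m [] [] [] [])
    rwa [conf_update_none] at this
  cases b with
  | true =>
    exact .seq runs_read_main (.ite_true rfl (.seq (h _ _) (.seq runs_read_main
      (.seq runs_read_main (.load _ _ _)))))
  | false =>
    exact (Runs.seq runs_read_main (.ite_false rfl (.seq (h _ _) (.load _ _ _)))).mono (by omega)

theorem exists_program : ∃ (p : StackProg) (d : ℕ), ∀ I : Instance,
    Runs p (none, false) (conf I.encode [] [] [] [] []) (none, false)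
      (conf [] [] [] [] [] [I.answer]) ((bound I + 2) ^ d) := by
  obtain ⟨-, -, p, t, ht, hp⟩ := feasible_answer
  have hlen : PowerBounded bound fun I => I.encode.length := PowerBounded.self.mono fun I =>
    (Nat.le_add_right _ 2).trans (Nat.le_mul_of_pos_right _ (Nat.succ_pos _))
  obtain ⟨d, hd⟩ := (((PowerBounded.const 17).mul hlen).add (.const 5)).add (ht.add (.const 6))
  refine ⟨.seq load (.seq p unload), d, fun I => ?_⟩
  obtain ⟨v, h⟩ := hp I (none, false) []
  exact (Runs.seq (runs_load I.encode (none, false)) (.seq h (runs_unload I.answer v))).mono (hd I)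

theorem computable_two_pow_kernelBound_pow (d : ℕ) :
    Computable fun r => (2 ^ kernelBound r + 3) ^ d := by
  have hpow : Primrec₂ ((· ^ ·) : ℕ → ℕ → ℕ) := Primrec₂.unpaired'.1 Nat.Primrec.pow
  have h3 : Primrec fun r : ℕ => 3 ^ (9 * r) :=
    hpow.comp (.const 3) (Primrec.nat_mul.comp (.const 9) .id)
  have hk : Primrec kernelBound := Primrec.nat_add.comp h3 (Primrec.nat_mul.comp
    (Primrec.nat_mul.comp (Primrec.nat_add.comp .id (.const 1))
      (Primrec.nat_mul.comp (.const 2) h3)) (hpow.comp (.const 4) h3))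
  exact (hpow.comp (Primrec.nat_add.comp (hpow.comp (.const 2) hk) (.const 3))
    (.const d)).to_comp

end SetGame

theorem theorem5 :
    IsFPT SetGame.Instance.encode SetGame.Instance.rounds SetGame.Instance.FirstPlayerWins := by
  open SetGame in
  obtain ⟨p, d, h⟩ := exists_program
  refine ⟨⟨p.machine (some .input) none (none, false), Equiv.refl _, Equiv.refl _⟩,
    fun r => (2 ^ kernelBound r + 3) ^ d * 2, (Polynomial.X + 3) ^ d, Instance.answer,
    ?_, Instance.answer_iff, fun I => ?_⟩
  · exact (Primrec.nat_mul.to_comp).comp (computable_two_pow_kernelBound_pow d) (.const 2)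
  · have hin : (Turing.initList (p.machine (some .input) none (none, false))
        (I.encode.map (Equiv.refl Symbol).symm)).stk = conf I.encode [] [] [] [] [] := by
      funext k
      rcases k with _ | ⟨⟨⟩⟩
      all_goals first | exact List.map_id _ | rfl
    have hout : (Turing.haltList (p.machine (some .input) none (none, false)) [I.answer]).stk =
        conf [] [] [] [] [] [I.answer] := by
      funext k; rcases k with _ | _ | _ <;> rfl
    obtain ⟨run⟩ := (h I).outputsInTime hin hout
    -- The factor 2 absorbs the final halting step, and `bound I + 2` is at most a product of a
    -- factor depending on the number of rounds and a factor linear in the input length.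
    have hle : (bound I + 2) ^ d + 1 ≤ (2 ^ kernelBound I.rounds + 3) ^ d * 2 *
        ((Polynomial.X + 3) ^ d : Polynomial ℕ).eval I.encode.length := by
      have h₁ : bound I + 2 ≤ (2 ^ kernelBound I.rounds + 3) * (I.encode.length + 3) := by
        rw [bound]
        generalize 2 ^ kernelBound I.rounds = g
        generalize I.encode.length = m
        nlinarith
      have h₂ := Nat.pow_le_pow_left h₁ d
      have h₃ : 1 ≤ (bound I + 2) ^ d := Nat.one_le_pow _ _ (by omega)
      rw [mul_pow] at h₂
      simp only [Polynomial.eval_pow, Polynomial.eval_add, Polynomial.eval_X,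
        Polynomial.eval_ofNat]
      linarith
    exact ⟨run.toEvalsTo, run.steps_le_m.trans hle⟩
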